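/- **Model.** There are $n$ items and one buyer, whose type is a valuation $v:2^{[n]}\to\mathbb R_{\ge 0}$ drawn from a known prior $D$. The valuation $v$ is *XOS* if $v(S)=\max_{j\le d}\sum_{i\in S}a_{j,i}$ for some $d\ge 1$ and $a_{j,i}\ge 0$. An *auction protocol* is a (possibly infinite) binary tree in which every internal node belongs to the Buyer or to Chance, every Chance node carries a probability distribution on its two children, and every leaf carries a bundle allocated to the buyer and a payment $\ge 0$, together with a suggested strategy (a choice of child at each Buyer node) for every type. For $\gamma\ge0$, the protocol is *$\gamma$-almost truthful in expectation* for $D$ if every strategy reaches a leaf with probability $1$, some strategy guarantees expected payment $0$ and the empty allocation, and no type $v$ in the support of $D$ can increase its expected utility (expected value minus expected payment) by more than $\gamma\, v([n])$ by deviating from its suggested strategy; $\gamma=0$ is exact truthfulness. It is *$\tau$-approximate* if its expected revenue, when every type follows its suggested strategy, is at least $\tau$ times the expected revenue of every incentive compatible, interim individually rational direct mechanism for $D$ with lotteries over bundles and nonnegative payments. Its *worst-case expected communication* is the supremum over strategies of the expected depth of the leaf reached; its *ex ante expected communication* is the expected depth of that leaf over $v\sim D$ and Chance when $v$ follows its suggested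 strategy. An *$(\varepsilon,\delta)$-design* on a finite set $G$ is a family of subsets of $G$ of size $\lfloor\varepsilon|G|\rfloor$ any two distinct members of which share at most $(1+\delta)\varepsilon^2|G|$ elements. For a family $B$ of subsets of $[n]$ let $\mathrm{BXOS}_B(S)=\max_{A\in B}|A\cap S|$. **Statement.** For every $\tau>0$ and every $\kappa>0$ there are $\varepsilon_0,\delta_0,\varepsilon_1,\delta_1,\varepsilon_2\in(0,\kappa)$, an integer $\ell$, and $\alpha>0$, $\gamma>0$, $n_0$ (all depending only on $\tau$ and $\kappa$) such that for every $n\ge n_0$ there are an $(\varepsilon_0,\delta_0)$-design $X$ on $[n]$ with $|X|\ge 2^{\alpha n}$, a nonempty $(\varepsilon_1,\delta_1)$-design $Y$ on the set $X$ with $|Y|\ge 2^{\alpha|X|}$, and $c:Y\to\{1,\varepsilon_2,\dots,\varepsilon_2^{\ell-1}\}$ with the following property. Let $D$ be the law of $v_c^x(S)=c(x)\cdot\mathrm{BXOS}_x(S)$ for $x$ uniform in $Y$ (each $x\in Y$ being a family of members of $X$). Then all valuations in the support of $D$ are XOS, and every $\tau$-approximate, $\gamma$-almost truthful-in-expectation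 protocol for $D$ (in particular, every exactly truthful one) has ex ante expected communication at least $2^{\alpha n}$, and hence also worst-case expected communication at least $2^{\alpha n}$. -/

import Mathlib

open scoped NNReal ENNReal

namespace Auction

/-- A (combinatorial) valuation of the bundles of `n` items. -/
abbrev Valuation (n : ℕ) : Type := Finset (Fin n) → ℝ≥0

/-- XOS valuations: a maximum of finitely many additive valuations. -/
def IsXOS {n : ℕ} (v : Valuation n) : Prop :=
  ∃ (d : ℕ) (a : Fin d → Fin n → ℝ≥0), 0 < d ∧
    ∀ S : Finset (Fin n), v S = Finset.univ.sup (fun j : Fin d => ∑ i ∈ S, a j i)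

/-! ### Auction protocols -/

/-- The label of a node of a protocol tree. The distribution at a node of Chance is over its two
children; a leaf carries the bundle allocated to the buyer and his payment. -/
inductive Node (n : ℕ) : Type
  | buyer : Node n
  | chance (μ : PMF Bool) : Node n
  | leaf (alloc : Finset (Fin n)) (pay : ℝ≥0) : Node n

/-- A possibly infinite binary tree. A node is addressed by the bits on the path that leads to it
from the root, the most recent bit first, so that its depth is the length of its address; labels
at addresses below a leaf play no role. -/
abbrev ProtocolTree (n : ℕ) : Type := List Bool → Node n

/-- A buyer's strategy: a choice of a child for every buyer's node. -/
abbrev Strategy : Type := List Bool → Bool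

/-- The probability that the node with the given address is reached. -/
noncomputable def ProtocolTree.reach {n : ℕ} (T : ProtocolTree n) (s : Strategy) :
    List Bool → ℝ≥0∞
  | [] => 1
  | b :: w => T.reach s w *
      match T w with
      | Node.buyer => if s w = b then 1 else 0
      | Node.chance μ => μ b
      | Node.leaf _ _ => 0

/-- The expectation, over the nodes of Chance, of a function `f` of the leaf that is reached: of its
address, its allocation and its payment. -/
noncomputable def ProtocolTree.expect {n : ℕ} (T : ProtocolTree n) (s : Strategy)
    (f : List Bool → Finset (Fin n) → ℝ≥0 → ℝ≥0∞) : ℝ≥0∞ :=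
  ∑' w : List Bool,
    match T w with
    | Node.leaf S q => T.reach s w * f w S q
    | _ => 0

/-- Expected payment. -/
noncomputable def ProtocolTree.expPay {n : ℕ} (T : ProtocolTree n) (s : Strategy) : ℝ≥0∞ :=
  T.expect s (fun _ _ q => (q : ℝ≥0∞))

/-- Expected value, before payment, of the allocation to a buyer with valuation `v`. -/
noncomputable def ProtocolTree.expValue {n : ℕ} (T : ProtocolTree n) (s : Strategy)
    (v : Valuation n) : ℝ≥0∞ :=
  T.expect s (fun _ S _ => (v S : ℝ≥0∞))

/-- Expected number of bits communicated: the expected depth of the leaf that is reached. -/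
noncomputable def ProtocolTree.expDepth {n : ℕ} (T : ProtocolTree n) (s : Strategy) : ℝ≥0∞ :=
  T.expect s (fun w _ _ => (w.length : ℝ≥0∞))

/-- Every buyer's strategy leads to a leaf with probability one. -/
def ProtocolTree.IsFinite {n : ℕ} (T : ProtocolTree n) : Prop :=
  ∀ s : Strategy, T.expect s (fun _ _ _ => 1) = 1

/-- Individual rationality: some strategy guarantees expected payment `0` and the empty
allocation. -/
def ProtocolTree.IsIR {n : ℕ} (T : ProtocolTree n) : Prop :=
  ∃ s : Strategy, T.expPay s = 0 ∧
    ∀ (w : List Bool) (S : Finset (Fin n)) (q : ℝ≥0),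
      T w = Node.leaf S q → T.reach s w ≠ 0 → S = ∅

/-- An auction protocol: a tree and a suggested map from types (valuations) to strategies. -/
structure Protocol (n : ℕ) : Type where
  tree : ProtocolTree n
  suggested : Valuation n → Strategy

/-- (Almost) incentive compatible, that is, (almost) truthful-in-expectation protocols for a buyer
with prior `D`: the tree is finite and individually rational, and no type `v` in the support of
`D` can gain more than `γ` times its value for all items in expected utility (value minus payment)
by deviating from its suggested strategy. The inequality between utilities is rearranged so that
no subtraction occurs and infinite expected payments are treated correctly. The case `γ = 0` is
exact incentive compatibility. -/
def Protocol.IsAlmostIC {n : ℕ} (P : Protocol n) (γ : ℝ≥0) (D : PMF (Valuation n)) : Prop :=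
  P.tree.IsFinite ∧ P.tree.IsIR ∧
    ∀ v ∈ D.support, ∀ s : Strategy,
      P.tree.expValue s v + P.tree.expPay (P.suggested v) ≤
        P.tree.expValue (P.suggested v) v + P.tree.expPay s + ((γ * v Finset.univ : ℝ≥0) : ℝ≥0∞)

/-- Expected revenue when the buyer's type is drawn from `D` and he follows the suggestion. -/
noncomputable def Protocol.revenue {n : ℕ} (P : Protocol n) (D : PMF (Valuation n)) : ℝ≥0∞ :=
  ∑' v : Valuation n, D v * P.tree.expPay (P.suggested v)

/-- Expected communication complexity: expected depth for a worst-case buyer's strategy. -/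
noncomputable def Protocol.worstCaseComm {n : ℕ} (P : Protocol n) : ℝ≥0∞ :=
  ⨆ s : Strategy, P.tree.expDepth s

/-- Ex ante expected communication: expected depth when the buyer's type is drawn from `D` and he
follows the suggestion. -/
noncomputable def Protocol.exAnteComm {n : ℕ} (P : Protocol n) (D : PMF (Valuation n)) : ℝ≥0∞ :=
  ∑' v : Valuation n, D v * P.tree.expDepth (P.suggested v)

/-! ### The benchmark: direct mechanisms -/

/-- A direct-revelation mechanism: for every reported type, a lottery over bundles and an expected
payment. -/
structure Mechanism (n : ℕ) : Type where
  lottery : Valuation n → PMF (Finset (Fin n))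
  pay : Valuation n → ℝ≥0

/-- Expected value of a buyer with valuation `v` for the lottery of the report `r`. -/
noncomputable def Mechanism.expValue {n : ℕ} (M : Mechanism n) (v r : Valuation n) : ℝ≥0∞ :=
  ∑ S : Finset (Fin n), M.lottery r S * (v S : ℝ≥0∞)

/-- Exact incentive compatibility and (interim) individual rationality on the support of `D`. -/
def Mechanism.IsTruthful {n : ℕ} (M : Mechanism n) (D : PMF (Valuation n)) : Prop :=
  (∀ v ∈ D.support, ∀ r ∈ D.support,
    M.expValue v r + (M.pay v : ℝ≥0∞) ≤ M.expValue v v + (M.pay r : ℝ≥0∞)) ∧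
  ∀ v ∈ D.support, (M.pay v : ℝ≥0∞) ≤ M.expValue v v

noncomputable def Mechanism.revenue {n : ℕ} (M : Mechanism n) (D : PMF (Valuation n)) : ℝ≥0∞ :=
  ∑' v : Valuation n, D v * (M.pay v : ℝ≥0∞)

/-- The protocol obtains at least a `τ` fraction of the optimal revenue, the supremum of the
revenues of all truthful mechanisms. -/
def Protocol.IsApproxOptimal {n : ℕ} (P : Protocol n) (τ : ℝ) (D : PMF (Valuation n)) : Prop :=
  ∀ M : Mechanism n, M.IsTruthful D → ENNReal.ofReal τ * M.revenue D ≤ P.revenue D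

/-! ### The hard instances -/

/-- A combinatorial design on the finite ground set `G`: a family of subsets of size `ε |G|`
(rounded down), any two distinct of which share at most `(1 + δ) ε² |G|` elements. -/
structure IsDesign {β : Type*} [DecidableEq β] (G : Finset β) (ε δ : ℝ)
    (X : Finset (Finset β)) : Prop where
  subset : ∀ x ∈ X, x ⊆ G
  card_eq : ∀ x ∈ X, x.card = ⌊ε * (G.card : ℝ)⌋₊
  inter_le : ∀ x ∈ X, ∀ y ∈ X, x ≠ y →
    ((x ∩ y).card : ℝ) ≤ (1 + δ) * ε ^ 2 * (G.card : ℝ)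

/-- The binary XOS function of a family `B` of bundles: `S ↦ max_{A ∈ B} |A ∩ S|`. -/
def bxos {n : ℕ} (B : Finset (Finset (Fin n))) (S : Finset (Fin n)) : ℕ :=
  B.sup (fun A => (A ∩ S).card)

/-- The valuation `S ↦ c(x) · BXOS_x(S)`, where the family of bundles is `x` itself. -/
noncomputable def scaledBxos {n : ℕ} (c : Finset (Finset (Fin n)) → ℝ≥0)
    (x : Finset (Finset (Fin n))) : Valuation n :=
  fun S => c x * (bxos x S : ℝ≥0)

/-- The prior: the valuation `scaledBxos c x` for a uniformly random member `x` of `Y`. -/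
noncomputable def hardPrior {n : ℕ} (Y : Finset (Finset (Finset (Fin n)))) (hY : Y.Nonempty)
    (c : Finset (Finset (Fin n)) → ℝ≥0) : PMF (Valuation n) :=
  (PMF.uniformOfFinset Y hY).map (scaledBxos c)

end Auction

namespace Auction

/-! ### Combinatorial designs -/

/-! A protocol cut off at depth `h` is, up to rounding, one of few menus, and independent random
scales for the families in `Y` make all of these menus collect little revenue at the same time.

Benchmark: distinct families share few members and distinct members overlap little, so a random
member of a type's own family has full value for that type and at most half of it for a type with
another family (`two_mul_sum_bxos_le`). Selling that lottery at half the full value is truthful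
(`exists_mechanism`), so the optimum is at least half of the expected full value.

Scales: let `x` have scale `ε₂ ^ i`, `i < ℓ`, with probability `ε₂ ^ (-i) / Z`. This is an
equal-revenue distribution: the mean scale is `ℓ / Z`, yet a fixed menu collects only `O(1 / Z)` on
average from each family, in units of the common set size, even if choices are merely almost optimal
(`sum_inv_pow_mul_pay_le`, `exists_payment_bound`). Independence over `Y` gives an error exponential
in `|Y|`, which beats a union bound over the menus (`exists_scales`, `exists_hard_scales`). One
choice of scales thus works for every protocol.

Counting: the number of rounded menus is doubly exponential in `h` (`card_menuClass_le`), while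
`|Y|` is doubly exponential in `n`, because `Y` is a design on a ground set that is itself
exponentially large. Hence `h` may be a multiple of `2 ^ (α n)` (`exists_depth`).

Reduction: strategies and entries of the rounded menu dominate each other up to small errors
(`roundMenu_approx`, `roundMenu_attained`), so almost incentive compatibility turns a suggested
strategy into an almost optimal entry with nearly the same payment (`exists_almost_optimal_entry`).
This fails only for types that go deep with substantial probability; their payments are bounded, and
small expected communication makes them rare (`scaledPay_le`). Summing over `Y` contradicts
approximate optimality (`le_exAnteComm`). -/

theorem exp_le_one_add_add_sq {t : ℝ} (h0 : 0 ≤ t) (h1 : t ≤ 1) :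
    Real.exp t ≤ 1 + t + t ^ 2 := by
  have := Real.abs_exp_sub_one_sub_id_le (x := t) (by rw [abs_of_nonneg h0]; exact h1)
  have := (abs_le.1 this).2
  linarith

/-- The exponential moment of the number of agreements with a fixed word. -/
theorem sum_exp_agree (k q : ℕ) (a : Fin k → Fin q) (t : ℝ) :
    ∑ w : Fin k → Fin q, Real.exp (t * ((Finset.univ.filter fun i => a i = w i).card : ℝ)) =
      ((q : ℝ) - 1 + Real.exp t) ^ k := by
  have h1 : ∀ w : Fin k → Fin q,
      Real.exp (t * ((Finset.univ.filter fun i => a i = w i).card : ℝ)) =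
        ∏ i, if a i = w i then Real.exp t else 1 := by
    intro w
    rw [Finset.prod_ite, Finset.prod_const, Finset.prod_const_one, mul_one, ← Real.exp_nat_mul,
      mul_comm]
  have h2 : ∀ i : Fin k, ∑ j : Fin q, (if a i = j then Real.exp t else 1) =
      (q : ℝ) - 1 + Real.exp t := by
    intro i
    have : ∀ j : Fin q, (if a i = j then Real.exp t else (1 : ℝ)) =
        1 + if a i = j then Real.exp t - 1 else 0 := by
      intro j; split_ifs <;> ring
    simp only [this, Finset.sum_add_distrib, Finset.sum_ite_eq, Finset.mem_univ, if_true,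
      Finset.sum_const, Finset.card_univ, Fintype.card_fin, nsmul_eq_mul]
    ring
  simp only [h1]
  have := Finset.prod_univ_sum (fun _ : Fin k => (Finset.univ : Finset (Fin q)))
    (fun i j => if a i = j then Real.exp t else (1 : ℝ))
  rw [Fintype.piFinset_univ] at this
  rw [← this]
  simp [h2]

/-- A Chernoff bound: the number of agreements with a uniformly random word has mean `k / q`. -/
theorem card_agree_le (k q : ℕ) (hq : 2 ≤ q) (a : Fin k → Fin q) {δ : ℝ} (h0 : 0 < δ)
    (h1 : δ ≤ 1) :
    ((Finset.univ.filter fun w : Fin k → Fin q =>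
      (1 + δ) * (k / q) ≤ ((Finset.univ.filter fun i => a i = w i).card : ℝ)).card : ℝ) ≤
      (q : ℝ) ^ k * Real.exp (-(δ ^ 2 / 4 * (k / q))) := by
  have hq0 : (0 : ℝ) < q := by positivity
  -- This choice minimizes `t + t ^ 2 - t * (1 + δ)`; the minimum is `-δ ^ 2 / 4`.
  set t := δ / 2 with ht
  have h2 : ((Finset.univ.filter fun w : Fin k → Fin q =>
      (1 + δ) * (k / q) ≤ ((Finset.univ.filter fun i => a i = w i).card : ℝ)).card : ℝ) *
      Real.exp (t * ((1 + δ) * (k / q))) ≤ ((q : ℝ) - 1 + Real.exp t) ^ k := by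
    rw [← sum_exp_agree k q a t, ← nsmul_eq_mul]
    refine (Finset.card_nsmul_le_sum _ _ _ ?_).trans
      (Finset.sum_le_sum_of_subset_of_nonneg (Finset.subset_univ _) fun _ _ _ =>
        (Real.exp_pos _).le)
    intro w hw
    have := (Finset.mem_filter.1 hw).2
    apply Real.exp_le_exp.2
    exact mul_le_mul_of_nonneg_left this (by positivity)
  have h3 : ((q : ℝ) - 1 + Real.exp t) ^ k ≤ (q : ℝ) ^ k * Real.exp ((k / q) * (t + t ^ 2)) := by
    have e1 : (q : ℝ) - 1 + Real.exp t ≤ q * Real.exp ((t + t ^ 2) / q) := by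
      have := exp_le_one_add_add_sq (t := t) (by positivity) (by linarith)
      have h5 := Real.add_one_le_exp ((t + t ^ 2) / q)
      have h6 : (q : ℝ) * ((t + t ^ 2) / q + 1) = t + t ^ 2 + q := by field_simp
      nlinarith [mul_le_mul_of_nonneg_left h5 hq0.le]
    have e2 : (0 : ℝ) ≤ (q : ℝ) - 1 + Real.exp t := by
      have : (2 : ℝ) ≤ q := by exact_mod_cast hq
      have := Real.exp_pos t
      linarith
    calc _ ≤ (q * Real.exp ((t + t ^ 2) / q)) ^ k := pow_le_pow_left₀ e2 e1 k
      _ = _ := by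
        rw [mul_pow, ← Real.exp_nat_mul]
        congr 2
        ring
  have h4 := h2.trans h3
  rw [← le_div_iff₀ (Real.exp_pos _), mul_div_assoc, ← Real.exp_sub] at h4
  refine h4.trans_eq ?_
  congr 2
  rw [ht]; ring

/-- A Gilbert–Varshamov bound. -/
theorem exists_code (k q : ℕ) (hq : 2 ≤ q) {δ : ℝ} (h0 : 0 < δ) (h1 : δ ≤ 1) :
    ∃ C : Finset (Fin k → Fin q),
      (∀ a ∈ C, ∀ b ∈ C, a ≠ b →
        ((Finset.univ.filter fun i => a i = b i).card : ℝ) ≤ (1 + δ) * (k / q)) ∧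
      Real.exp (δ ^ 2 / 4 * (k / q)) ≤ (C.card : ℝ) := by
  classical
  have hq0 : (0 : ℝ) < q := by positivity
  let good : Finset (Fin k → Fin q) → Prop := fun C => ∀ a ∈ C, ∀ b ∈ C, a ≠ b →
    ((Finset.univ.filter fun i => a i = b i).card : ℝ) ≤ (1 + δ) * (k / q)
  obtain ⟨C, hC, hmax⟩ := Finset.exists_max_image (Finset.univ.filter good) Finset.card
    ⟨∅, by simp [good]⟩
  have hC' : good C := (Finset.mem_filter.1 hC).2
  refine ⟨C, hC', ?_⟩
  have cover : ∀ w : Fin k → Fin q, ∃ a ∈ C,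
      (1 + δ) * (k / q) ≤ ((Finset.univ.filter fun i => a i = w i).card : ℝ) := by
    intro w
    by_cases hw : w ∈ C
    -- A codeword covers itself: it agrees in all `k` places, and `1 + δ ≤ 2 ≤ q`.
    · refine ⟨w, hw, ?_⟩
      simp only [Finset.filter_true, Finset.card_univ, Fintype.card_fin]
      rw [mul_div_assoc', div_le_iff₀ hq0]
      have : (2 : ℝ) ≤ q := by exact_mod_cast hq
      nlinarith [(Nat.cast_nonneg k : (0 : ℝ) ≤ k)]
    · by_contra! hcon
      have h5 : insert w C ∈ Finset.univ.filter good := by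
        simp only [good, Finset.mem_filter, Finset.mem_univ, true_and, Finset.mem_insert]
        rintro a (rfl | ha) b (rfl | hb) hab
        · exact absurd rfl hab
        · simpa only [eq_comm] using (hcon b hb).le
        · exact (hcon a ha).le
        · exact hC' a ha b hb hab
      have := hmax _ h5
      rw [Finset.card_insert_of_notMem hw] at this
      omega
  have h6 : (q : ℝ) ^ k ≤ C.card * ((q : ℝ) ^ k * Real.exp (-(δ ^ 2 / 4 * (k / q)))) := by
    have e1 : (Finset.univ : Finset (Fin k → Fin q)) ⊆ C.biUnion fun a =>
        Finset.univ.filter fun w : Fin k → Fin q =>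
          (1 + δ) * (k / q) ≤ ((Finset.univ.filter fun i => a i = w i).card : ℝ) := by
      intro w _
      obtain ⟨a, ha, haw⟩ := cover w
      exact Finset.mem_biUnion.2 ⟨a, ha, Finset.mem_filter.2 ⟨Finset.mem_univ _, haw⟩⟩
    have e2 := (Finset.card_le_card e1).trans Finset.card_biUnion_le
    rw [Finset.card_univ, Fintype.card_fun, Fintype.card_fin, Fintype.card_fin] at e2
    have e3 : ((q ^ k : ℕ) : ℝ) ≤ _ := Nat.cast_le.2 e2
    push_cast at e3
    refine e3.trans ?_
    rw [← nsmul_eq_mul]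
    exact Finset.sum_le_card_nsmul _ _ _ fun a _ => card_agree_le k q hq a h0 h1
  rw [Real.exp_neg] at h6
  have hp : (0 : ℝ) < (q : ℝ) ^ k := by positivity
  have he := Real.exp_pos (δ ^ 2 / 4 * (k / q))
  have h7 : (q : ℝ) ^ k * Real.exp (δ ^ 2 / 4 * (k / q)) ≤ C.card * (q : ℝ) ^ k := by
    calc _ ≤ (C.card * ((q : ℝ) ^ k * (Real.exp (δ ^ 2 / 4 * (k / q)))⁻¹)) *
          Real.exp (δ ^ 2 / 4 * (k / q)) := mul_le_mul_of_nonneg_right h6 he.le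
      _ = _ := by field_simp
  nlinarith [h7]

/-- Take `k = ⌊|G| / q⌋` disjoint blocks of `q` elements of `G`. A word of length `k` picks one
element from each block, so agreements of codewords become common elements of the sets. The `8` in
the exponent, in place of the `4` of `exists_code`, pays for the floor in `k`. -/
theorem exists_design {β : Type*} [DecidableEq β] (G : Finset β) (q : ℕ) (hq : 2 ≤ q) {δ : ℝ}
    (h0 : 0 < δ) (h1 : δ ≤ 1) (hG : 2 * q ≤ G.card) :
    ∃ X : Finset (Finset β), IsDesign G (1 / q) δ X ∧
      Real.exp (δ ^ 2 / (8 * q ^ 2) * G.card) ≤ (X.card : ℝ) := by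
  have hq0 : (0 : ℝ) < q := by positivity
  set N := G.card with hN
  set k := N / q with hk
  have hkq : k * q ≤ N := Nat.div_mul_le_self N q
  obtain ⟨C, hC, hcard⟩ := exists_code k q hq h0 h1
  let e : Fin k × Fin q → β := fun p => (G.equivFin.symm (Fin.castLE hkq (finProdFinEquiv p)) : β)
  have he : Function.Injective e := by
    intro p p' h
    have := G.equivFin.symm.injective (Subtype.ext h)
    exact finProdFinEquiv.injective (Fin.castLE_injective hkq this)
  let Φ : (Fin k → Fin q) → Finset β := fun w => Finset.univ.image fun i => e (i, w i)
  have hei : ∀ w : Fin k → Fin q, Function.Injective fun i => e (i, w i) := fun w i j h =>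
    congrArg Prod.fst (he h)
  have hcardΦ : ∀ w, (Φ w).card = k := fun w => by
    simp only [Φ]; rw [Finset.card_image_of_injective _ (hei w)]; simp
  have hinter : ∀ a b, Φ a ∩ Φ b ⊆
      (Finset.univ.filter fun i => a i = b i).image fun i => e (i, a i) := by
    intro a b z hz
    simp only [Φ, Finset.mem_inter, Finset.mem_image, Finset.mem_univ, true_and] at hz
    obtain ⟨⟨i, hi⟩, j, hj⟩ := hz
    have h := he (hi.trans hj.symm)
    simp only [Prod.mk.injEq] at h
    obtain ⟨rfl, h⟩ := h
    exact Finset.mem_image.2 ⟨i, Finset.mem_filter.2 ⟨Finset.mem_univ _, h⟩, hi⟩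
  have hinj : Function.Injective Φ := by
    intro a b hab
    funext i
    have : e (i, a i) ∈ Φ b := hab ▸ Finset.mem_image.2 ⟨i, Finset.mem_univ _, rfl⟩
    obtain ⟨j, _, hj⟩ := Finset.mem_image.1 this
    have h := he hj
    simp only [Prod.mk.injEq] at h
    obtain ⟨rfl, h⟩ := h
    exact h.symm
  have hkN : (k : ℝ) ≤ N / q := by
    rw [le_div_iff₀ hq0]; exact_mod_cast hkq
  refine ⟨C.image Φ, ⟨?_, ?_, ?_⟩, ?_⟩
  · intro x hx
    obtain ⟨w, _, rfl⟩ := Finset.mem_image.1 hx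
    intro z hz
    obtain ⟨i, _, rfl⟩ := Finset.mem_image.1 hz
    exact Subtype.prop _
  · intro x hx
    obtain ⟨w, _, rfl⟩ := Finset.mem_image.1 hx
    rw [hcardΦ, ← hN, one_div_mul_eq_div, Nat.floor_div_natCast, Nat.floor_natCast]
  · intro x hx y hy hxy
    obtain ⟨a, ha, rfl⟩ := Finset.mem_image.1 hx
    obtain ⟨b, hb, rfl⟩ := Finset.mem_image.1 hy
    have hab : a ≠ b := fun h => hxy (h ▸ rfl)
    have h2 : ((Φ a ∩ Φ b).card : ℝ) ≤ ((Finset.univ.filter fun i => a i = b i).card : ℝ) :=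
      Nat.cast_le.2 ((Finset.card_le_card (hinter a b)).trans Finset.card_image_le)
    refine h2.trans ((hC a ha b hb hab).trans ?_)
    rw [mul_assoc]
    apply mul_le_mul_of_nonneg_left _ (by linarith)
    calc (k : ℝ) / q ≤ (N / q) / q := by gcongr
      _ = _ := by rw [← hN]; field_simp
  · rw [Finset.card_image_of_injective _ hinj]
    refine le_trans (Real.exp_le_exp.2 ?_) hcard
    have hk2 : (N : ℝ) / (2 * q) ≤ k := by
      have e1 : N < (k + 1) * q := by
        have := Nat.lt_succ_iff.2 (le_refl (N / q))
        exact (Nat.div_lt_iff_lt_mul (by omega)).1 this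
      have e2 : 2 ≤ k := (Nat.le_div_iff_mul_le (by omega)).2 hG
      rw [div_le_iff₀ (by positivity)]
      have e3 : N ≤ k * (2 * q) := by nlinarith
      exact_mod_cast e3
    calc δ ^ 2 / (8 * q ^ 2) * (N : ℝ) = δ ^ 2 / 4 * ((N / (2 * q)) / q) := by field_simp; ring
      _ ≤ _ := by gcongr

/-! ### Subtrees -/

variable {n : ℕ}

/-- The subtree below a child of the root. -/
def ProtocolTree.child (T : ProtocolTree n) (b : Bool) : ProtocolTree n := fun w => T (w ++ [b])

/-- The restriction of a strategy to the subtree below a child of the root. -/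
def childStrategy (s : Strategy) (b : Bool) : Strategy := fun w => s (w ++ [b])

/-- The strategy with given choice at the root and given restrictions to the subtrees. -/
def glueStrategy (c : Bool) (σ : Bool → Strategy) : Strategy := fun w =>
  match w.getLast? with
  | none => c
  | some b => σ b w.dropLast

@[simp] theorem glueStrategy_nil (c : Bool) (σ : Bool → Strategy) : glueStrategy c σ [] = c := rfl

@[simp] theorem childStrategy_glueStrategy (c : Bool) (σ : Bool → Strategy) (b : Bool) :
    childStrategy (glueStrategy c σ) b = σ b := by
  funext w
  simp [childStrategy, glueStrategy]

/-- The probability of moving from the root to its child `b`. -/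
noncomputable def ProtocolTree.stepProb (T : ProtocolTree n) (s : Strategy) (b : Bool) : ℝ≥0∞ :=
  match T [] with
  | Node.buyer => if s [] = b then 1 else 0
  | Node.chance μ => μ b
  | Node.leaf _ _ => 0

/-- `reach` recurses at the most recent bit, whereas induction on the tree must split off the move
at the root, which is the last bit of an address. -/
theorem ProtocolTree.reach_append (T : ProtocolTree n) (s : Strategy) (b : Bool) (w : List Bool) :
    T.reach s (w ++ [b]) = T.stepProb s b * (T.child b).reach (childStrategy s b) w := by
  induction w with
  | nil =>
    simp only [List.nil_append, ProtocolTree.reach, ProtocolTree.stepProb, one_mul, mul_one]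
  | cons a w ih =>
    simp only [List.cons_append, ProtocolTree.reach]
    rw [ih, mul_assoc]
    rfl

/-- A list is empty or has a last element. -/
noncomputable def listSnocEquiv : Option (Bool × List Bool) ≃ List Bool :=
  Equiv.ofBijective (fun o => o.elim [] fun p => p.2 ++ [p.1]) <| by
    constructor
    · rintro (_ | ⟨b, w⟩) (_ | ⟨b', w'⟩) h
      · rfl
      · simp at h
      · simp at h
      · simp only [Option.elim_some] at h
        have := List.append_inj' h rfl
        simp_all
    · intro w
      rcases List.eq_nil_or_concat w with rfl | ⟨w, b, rfl⟩
      · exact ⟨none, rfl⟩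
      · exact ⟨some (b, w), by simp⟩

theorem tsum_list_bool (F : List Bool → ℝ≥0∞) :
    ∑' w, F w = F [] + ∑ b : Bool, ∑' w, F (w ++ [b]) := by
  rw [← listSnocEquiv.tsum_eq F]
  have : ∑' o : Option (Bool × List Bool), F (listSnocEquiv o) =
      F (listSnocEquiv none) + ∑' p : Bool × List Bool, F (listSnocEquiv (some p)) := by
    rw [← (Equiv.optionEquivSumPUnit.{0} (Bool × List Bool)).symm.tsum_eq,
      Summable.tsum_sum ENNReal.summable ENNReal.summable, add_comm]
    simp
  rw [this, ENNReal.tsum_prod', tsum_fintype]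
  rfl

theorem ProtocolTree.expect_eq (T : ProtocolTree n) (s : Strategy)
    (f : List Bool → Finset (Fin n) → ℝ≥0 → ℝ≥0∞) :
    T.expect s f = (match T [] with | Node.leaf S q => f [] S q | _ => 0) +
      ∑ b : Bool, T.stepProb s b *
        (T.child b).expect (childStrategy s b) fun w => f (w ++ [b]) := by
  rw [ProtocolTree.expect, tsum_list_bool]
  congr 1
  · rcases T [] with _ | _ | _ <;> simp [ProtocolTree.reach]
  · refine Finset.sum_congr rfl fun b _ => ?_
    rw [ProtocolTree.expect, ← ENNReal.tsum_mul_left]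
    refine tsum_congr fun w => ?_
    rw [ProtocolTree.reach_append]
    have : (T.child b) w = T (w ++ [b]) := rfl
    rw [this]
    rcases T (w ++ [b]) with _ | _ | _ <;> simp [mul_assoc]

theorem ProtocolTree.expect_of_leaf {T : ProtocolTree n} {S : Finset (Fin n)} {q : ℝ≥0}
    (h : T [] = Node.leaf S q) (s : Strategy) (f : List Bool → Finset (Fin n) → ℝ≥0 → ℝ≥0∞) :
    T.expect s f = f [] S q := by
  rw [T.expect_eq, h]
  simp [ProtocolTree.stepProb, h]

theorem ProtocolTree.expect_of_buyer {T : ProtocolTree n} (h : T [] = Node.buyer) (s : Strategy)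
    (f : List Bool → Finset (Fin n) → ℝ≥0 → ℝ≥0∞) :
    T.expect s f =
      (T.child (s [])).expect (childStrategy s (s [])) fun w => f (w ++ [s []]) := by
  rw [T.expect_eq, h]
  simp [ProtocolTree.stepProb, h]

theorem ProtocolTree.expect_of_chance {T : ProtocolTree n} {μ : PMF Bool}
    (h : T [] = Node.chance μ) (s : Strategy)
    (f : List Bool → Finset (Fin n) → ℝ≥0 → ℝ≥0∞) :
    T.expect s f =
      μ true * ((T.child true).expect (childStrategy s true) fun w => f (w ++ [true])) +
      μ false * ((T.child false).expect (childStrategy s false) fun w => f (w ++ [false])) := by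
  rw [T.expect_eq, h]
  simp [ProtocolTree.stepProb, h]

theorem ProtocolTree.expect_mono (T : ProtocolTree n) (s : Strategy)
    {f g : List Bool → Finset (Fin n) → ℝ≥0 → ℝ≥0∞} (h : ∀ w S q, f w S q ≤ g w S q) :
    T.expect s f ≤ T.expect s g := by
  refine ENNReal.tsum_le_tsum fun w => ?_
  rcases T w with _ | _ | _
  · exact le_rfl
  · exact le_rfl
  · exact mul_le_mul_right (h _ _ _) _

theorem ProtocolTree.expect_const_mul (T : ProtocolTree n) (s : Strategy) (a : ℝ≥0∞)
    (f : List Bool → Finset (Fin n) → ℝ≥0 → ℝ≥0∞) :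
    T.expect s (fun w S q => a * f w S q) = a * T.expect s f := by
  rw [ProtocolTree.expect, ProtocolTree.expect, ← ENNReal.tsum_mul_left]
  refine tsum_congr fun w => ?_
  rcases T w with _ | _ | _
  · simp
  · simp
  · simp only []; ring

/-! ### Rounded menus -/

/-- `M • y`, truncated at `3 M` and rounded down. -/
noncomputable def roundDown (M : ℕ) (y : ℝ≥0∞) : ℕ := ⌊(M : ℝ) * (min y 3).toReal⌋₊

theorem roundDown_le (M : ℕ) (y : ℝ≥0∞) : (roundDown M y : ℝ≥0∞) ≤ M * y := by
  have h3 : min y 3 ≠ ⊤ := ne_top_of_le_ne_top (by simp) (min_le_right _ _)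
  have : (roundDown M y : ℝ) ≤ M * (min y 3).toReal := Nat.floor_le (by positivity)
  have h := ENNReal.ofReal_le_ofReal this
  rw [ENNReal.ofReal_natCast, ENNReal.ofReal_mul (by positivity), ENNReal.ofReal_natCast,
    ENNReal.ofReal_toReal h3] at h
  exact h.trans (mul_le_mul_right (min_le_left _ _) _)

theorem roundDown_le_cap (M : ℕ) (y : ℝ≥0∞) : roundDown M y ≤ 3 * M := by
  have h3 : (min y 3).toReal ≤ 3 := by
    have := ENNReal.toReal_mono (by simp) (min_le_right y 3)
    simpa using this
  have : (roundDown M y : ℝ) ≤ ((3 * M : ℕ) : ℝ) := by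
    refine (Nat.floor_le (by positivity)).trans ?_
    push_cast
    nlinarith [(Nat.cast_nonneg M : (0 : ℝ) ≤ M)]
  exact_mod_cast this

theorem lt_roundDown_add_one (M : ℕ) (y : ℝ≥0∞) (h : roundDown M y < 3 * M) :
    M * y < roundDown M y + 1 := by
  have hy : y < 3 := by
    by_contra! hy
    apply h.ne
    rw [roundDown, min_eq_right hy]
    have : (M : ℝ) * (3 : ℝ≥0∞).toReal = ((3 * M : ℕ) : ℝ) := by
      rw [ENNReal.toReal_ofNat]; push_cast; ring
    rw [this, Nat.floor_natCast]
  have h1 : (M : ℝ) * y.toReal < roundDown M y + 1 := by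
    have := Nat.lt_floor_add_one ((M : ℝ) * (min y 3).toReal)
    rw [min_eq_left hy.le] at this
    rw [roundDown, min_eq_left hy.le]
    exact this
  have hyt : y ≠ ⊤ := (hy.trans (by simp)).ne
  have h2 := (ENNReal.ofReal_lt_ofReal_iff (by positivity)).2 h1
  rw [ENNReal.ofReal_mul (by positivity), ENNReal.ofReal_natCast, ENNReal.ofReal_toReal hyt,
    ENNReal.ofReal_add (by positivity) zero_le_one, ENNReal.ofReal_natCast, ENNReal.ofReal_one] at h2
  exact h2

/-- An entry of a rounded menu: the weights of the bundles and the payment, as multiples of the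
rounding unit. -/
abbrev Entry (n : ℕ) : Type := (Finset (Fin n) → ℕ) × ℕ

/-- The value of an entry for a buyer with value `g S` for the bundle `S`. -/
noncomputable def Entry.value (e : Entry n) (g : Finset (Fin n) → ℝ≥0∞) : ℝ≥0∞ :=
  ∑ S, (e.1 S : ℝ≥0∞) * g S

theorem Entry.value_add (e e' : Entry n) (g : Finset (Fin n) → ℝ≥0∞) :
    Entry.value (e + e') g = Entry.value e g + Entry.value e' g := by
  simp [Entry.value, add_mul, Finset.sum_add_distrib]

/-- The entry that carries the weight `a` on the single bundle `S`. -/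
def Entry.single (S : Finset (Fin n)) (a p : ℕ) : Entry n := (Pi.single S a, p)

theorem Entry.value_single (S : Finset (Fin n)) (a p : ℕ) (g : Finset (Fin n) → ℝ≥0∞) :
    Entry.value (Entry.single S a p) g = a * g S := by
  rw [Entry.value, Finset.sum_eq_single S]
  · simp [Entry.single]
  · intro b _ hb
    simp [Entry.single, Pi.single_eq_of_ne hb]
  · simp

/-- Expected payment in units of `κ⁻¹`. -/
noncomputable def ProtocolTree.scaledPay (T : ProtocolTree n) (κ : ℝ≥0∞) (s : Strategy) : ℝ≥0∞ :=
  T.expect s fun _ _ q => κ * q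

/-- Probability of reaching a leaf of depth at least `h`. -/
noncomputable def ProtocolTree.deepProb (T : ProtocolTree n) (h : ℕ) (s : Strategy) : ℝ≥0∞ :=
  T.expect s fun w _ _ => if h ≤ w.length then 1 else 0

open scoped Classical in
/-- The menu that the first `h` levels of a protocol tree, entered with probability `r`, offer to
the buyer, with rounded weights and payments. At depth `h` the remaining allocation is
dropped, and the least expected payment is charged. -/
noncomputable def roundMenu (M : ℕ) (κ : ℝ≥0∞) :
    ℕ → ℝ≥0∞ → ProtocolTree n → Finset (Entry n)
  | 0, r, T => {Entry.single ∅ 0 (roundDown M (⨅ s, r * T.scaledPay κ s))}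
  | h + 1, r, T =>
    match T [] with
    | Node.leaf S q => {Entry.single S (roundDown M r) (roundDown M (r * (κ * q)))}
    | Node.buyer => roundMenu M κ h r (T.child true) ∪ roundMenu M κ h r (T.child false)
    | Node.chance μ => Finset.image₂ (· + ·) (roundMenu M κ h (r * μ true) (T.child true))
        (roundMenu M κ h (r * μ false) (T.child false))

open scoped Classical in
/-- All menus that rounding at depth `h` can produce. -/
noncomputable def menuClass (n M : ℕ) : ℕ → Finset (Finset (Entry n))
  | 0 => (Finset.range (3 * M + 1)).image fun p => {Entry.single ∅ 0 p}
  | h + 1 =>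
    ((Finset.univ : Finset (Finset (Fin n))) ×ˢ
      (Finset.range (3 * M + 1) ×ˢ Finset.range (3 * M + 1))).image
        (fun t => {Entry.single t.1 t.2.1 t.2.2}) ∪
    (Finset.image₂ (· ∪ ·) (menuClass n M h) (menuClass n M h) ∪
     Finset.image₂ (Finset.image₂ (· + ·)) (menuClass n M h) (menuClass n M h))

theorem roundMenu_mem (M : ℕ) (κ : ℝ≥0∞) (h : ℕ) :
    ∀ (r : ℝ≥0∞) (T : ProtocolTree n), roundMenu M κ h r T ∈ menuClass n M h := by
  classical
  induction h with
  | zero =>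
    intro r T
    exact Finset.mem_image.2 ⟨_, Finset.mem_range.2 (Nat.lt_succ_iff.2 (roundDown_le_cap _ _)), rfl⟩
  | succ h ih =>
    intro r T
    simp only [roundMenu, menuClass, Finset.mem_union]
    rcases T [] with _ | μ | ⟨S, q⟩
    · right; left
      exact Finset.mem_image₂_of_mem (ih _ _) (ih _ _)
    · right; right
      exact Finset.mem_image₂_of_mem (ih _ _) (ih _ _)
    · left
      refine Finset.mem_image.2 ⟨(S, roundDown M r, roundDown M (r * (κ * q))), ?_, rfl⟩
      simp only [Finset.mem_product, Finset.mem_univ, Finset.mem_range, true_and]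
      exact ⟨Nat.lt_succ_iff.2 (roundDown_le_cap _ _), Nat.lt_succ_iff.2 (roundDown_le_cap _ _)⟩

/-- The recursion has the form `N ↦ L + 2 * N ^ 2`. The factors `3` and `9` make the induction
close: `3 * N ≤ A` and `9 * L ≤ A` give `3 * (L + 2 * N ^ 2) ≤ A ^ 2`. -/
theorem card_menuClass_le (n M h : ℕ) :
    3 * (menuClass n M h).card ≤ (9 * (2 ^ n * (3 * M + 1) ^ 2)) ^ 2 ^ h := by
  classical
  set L := 2 ^ n * (3 * M + 1) ^ 2 with hL
  have hL1 : 3 * M + 1 ≤ L := by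
    have : 1 ≤ 2 ^ n := Nat.one_le_two_pow
    nlinarith
  induction h with
  | zero =>
    have : (menuClass n M 0).card ≤ 3 * M + 1 := by
      rw [menuClass]
      exact Finset.card_image_le.trans_eq (Finset.card_range _)
    simp only [pow_zero, pow_one]
    omega
  | succ h ih =>
    have e1 : (menuClass n M (h + 1)).card ≤
        L + ((menuClass n M h).card * (menuClass n M h).card +
          (menuClass n M h).card * (menuClass n M h).card) := by
      rw [menuClass]
      refine (Finset.card_union_le _ _).trans (add_le_add ?_ ((Finset.card_union_le _ _).trans
        (add_le_add (Finset.card_image₂_le _ _ _) (Finset.card_image₂_le _ _ _))))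
      refine Finset.card_image_le.trans_eq ?_
      simp [hL, sq]
    set A := (9 * L) ^ 2 ^ h with hA
    have e2 : (9 * L) ^ 2 ^ (h + 1) = A * A := by rw [pow_succ, pow_mul, sq]
    have e3 : 9 * L ≤ A := by
      have : (9 * L) ^ 1 ≤ (9 * L) ^ 2 ^ h := Nat.pow_le_pow_right (by omega) Nat.one_le_two_pow
      simpa using this
    rw [e2]
    set N := (menuClass n M h).card
    nlinarith

theorem expect_append_length (T : ProtocolTree n) (s : Strategy) (h : ℕ) (b : Bool) :
    (T.expect s fun w _ _ => if h + 1 ≤ (w ++ [b]).length then 1 else 0) = T.deepProb h s := by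
  simp [ProtocolTree.deepProb]

/-- Rounding loses at most one unit at each of at most `2 ^ h` ends of the truncated tree, and
dropping the allocation at depth `h` loses at most the probability of getting there. Rounding takes
place with absolute weights `r`, so that errors add and are not multiplied along a path. The entry
depends on the strategy alone and serves all `g`. -/
theorem roundMenu_approx (M : ℕ) (κ : ℝ≥0∞) (h : ℕ) :
    ∀ (r : ℝ≥0∞) (_ : r ≤ 1) (T : ProtocolTree n) (s : Strategy),
      ∃ e ∈ roundMenu M κ h r T, (e.2 : ℝ≥0∞) ≤ M * (r * T.scaledPay κ s) ∧
        ∀ g : Finset (Fin n) → ℝ≥0∞, (∀ S, g S ≤ 1) →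
          Entry.value e g ≤ M * (r * T.expect s fun _ S _ => g S) ∧
          M * (r * T.expect s fun _ S _ => g S) ≤
            Entry.value e g + 2 ^ h + M * (r * T.deepProb h s) := by
  classical
  induction h with
  | zero =>
    intro r _ T s
    refine ⟨_, Finset.mem_singleton_self _, ?_, fun g hg => ⟨?_, ?_⟩⟩
    · exact (roundDown_le _ _).trans (mul_le_mul_right (iInf_le _ s) _)
    · simp [Entry.value_single]
    · refine le_trans ?_ le_add_self
      gcongr
      refine T.expect_mono s fun w S q => ?_
      simpa using hg S
  | succ h ih =>
    intro r hr T s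
    rcases hT : T [] with _ | μ | ⟨S, q⟩
    · obtain ⟨e, he, hp, hv⟩ := ih r hr (T.child (s [])) (childStrategy s (s []))
      refine ⟨e, ?_, ?_, fun g hg => ⟨?_, ?_⟩⟩
      · rw [roundMenu, hT]
        cases hs : s [] <;> rw [hs] at he <;> simp [he]
      · rwa [ProtocolTree.scaledPay, T.expect_of_buyer hT]
      · rw [T.expect_of_buyer hT]
        exact (hv g hg).1
      · rw [T.expect_of_buyer hT, ProtocolTree.deepProb, T.expect_of_buyer hT,
          expect_append_length]
        refine (hv g hg).2.trans ?_
        gcongr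
        · norm_num
        · omega
    · have hb : ∀ b, r * μ b ≤ 1 := fun b => mul_le_one' hr (μ.coe_le_one b)
      obtain ⟨e, he, hp, hv⟩ := ih (r * μ true) (hb _) (T.child true) (childStrategy s true)
      obtain ⟨e', he', hp', hv'⟩ := ih (r * μ false) (hb _) (T.child false)
        (childStrategy s false)
      have key : ∀ x y : ℝ≥0∞, M * (r * (μ true * x + μ false * y)) =
          M * (r * μ true * x) + M * (r * μ false * y) := fun x y => by ring
      refine ⟨e + e', ?_, ?_, fun g hg => ⟨?_, ?_⟩⟩
      · rw [roundMenu, hT]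
        exact Finset.mem_image₂_of_mem he he'
      · rw [ProtocolTree.scaledPay, T.expect_of_chance hT, key]
        simp only [Prod.snd_add, Nat.cast_add]
        exact add_le_add hp hp'
      · rw [T.expect_of_chance hT, key, Entry.value_add]
        exact add_le_add (hv g hg).1 (hv' g hg).1
      · rw [T.expect_of_chance hT, key, Entry.value_add, ProtocolTree.deepProb,
          T.expect_of_chance hT, key, expect_append_length, expect_append_length]
        refine (add_le_add (hv g hg).2 (hv' g hg).2).trans_eq ?_
        ring
    · refine ⟨Entry.single S (roundDown M r) (roundDown M (r * (κ * q))), ?_, ?_,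
        fun g hg => ⟨?_, ?_⟩⟩
      · rw [roundMenu, hT]
        exact Finset.mem_singleton_self _
      · rw [ProtocolTree.scaledPay, T.expect_of_leaf hT]
        exact roundDown_le _ _
      · rw [T.expect_of_leaf hT, Entry.value_single, ← mul_assoc]
        gcongr
        exact roundDown_le _ _
      · rw [T.expect_of_leaf hT, Entry.value_single, ← mul_assoc]
        refine le_trans ?_ le_self_add
        rcases Nat.eq_zero_or_pos M with rfl | hM
        · simp
        -- Since `r ≤ 1`, truncation does not affect the weights.
        have hlt : roundDown M r < 3 * M := by
          have h1 : (roundDown M r : ℝ≥0∞) ≤ M :=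
            (roundDown_le M r).trans (by simpa using mul_le_mul_right hr (M : ℝ≥0∞))
          have : roundDown M r ≤ M := by exact_mod_cast h1
          omega
        calc (M : ℝ≥0∞) * r * g S ≤ (roundDown M r + 1) * g S := by
              gcongr; exact (lt_roundDown_add_one M r hlt).le
          _ = roundDown M r * g S + g S := by ring
          _ ≤ _ := by
            gcongr
            exact (hg S).trans (one_le_pow_of_one_le' one_le_two _)

/-- Rounding down makes an entry look cheaper by at most one unit per end of the truncated tree, and
never more valuable. A payment at the cap may hide an arbitrarily large one, hence the bound on
`e.2`. At a node of Chance the strategies found for the two subtrees are glued. -/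
theorem roundMenu_attained (M : ℕ) (κ : ℝ≥0∞) (h : ℕ) :
    ∀ (r : ℝ≥0∞) (T : ProtocolTree n), ∀ e ∈ roundMenu M κ h r T, e.2 < 3 * M →
      ∃ s : Strategy, M * (r * T.scaledPay κ s) ≤ e.2 + 2 ^ h ∧
        ∀ g : Finset (Fin n) → ℝ≥0∞,
          Entry.value e g ≤ M * (r * T.expect s fun _ S _ => g S) := by
  classical
  induction h with
  | zero =>
    intro r T e he hlt
    obtain rfl := Finset.mem_singleton.1 he
    have h1 := lt_roundDown_add_one M _ hlt
    have : ∃ s, M * (r * T.scaledPay κ s) < roundDown M (⨅ s, r * T.scaledPay κ s) + 1 := by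
      -- The infimum need not be attained; the strict gap of one unit yields a strategy. Here `M ≠
      -- 0`, as otherwise `hlt` fails.
      rw [ENNReal.mul_iInf_of_ne (by rintro h0; simp [Nat.cast_eq_zero.1 h0] at hlt) (by simp),
        iInf_lt_iff] at h1
      exact h1
    obtain ⟨s, hs⟩ := this
    refine ⟨s, ?_, fun g => ?_⟩
    · simpa [Entry.single] using hs.le
    · simp [Entry.value_single]
  | succ h ih =>
    intro r T e he hlt
    rcases hT : T [] with _ | μ | ⟨S, q⟩
    · rw [roundMenu, hT] at he
      have : ∃ b, e ∈ roundMenu M κ h r (T.child b) := by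
        rcases Finset.mem_union.1 he with he | he
        exacts [⟨true, he⟩, ⟨false, he⟩]
      obtain ⟨b, hb⟩ := this
      obtain ⟨s, hs, hv⟩ := ih _ _ _ hb hlt
      refine ⟨glueStrategy b fun _ => s, ?_, fun g => ?_⟩
      · rw [ProtocolTree.scaledPay, T.expect_of_buyer hT, glueStrategy_nil,
          childStrategy_glueStrategy]
        refine hs.trans ?_
        gcongr
        · norm_num
        · omega
      · rw [T.expect_of_buyer hT, glueStrategy_nil, childStrategy_glueStrategy]
        exact hv g
    · rw [roundMenu, hT] at he
      obtain ⟨e₁, h₁, e₂, h₂, rfl⟩ := Finset.mem_image₂.1 he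
      simp only [Prod.snd_add] at hlt
      obtain ⟨s₁, hs₁, hv₁⟩ := ih _ _ _ h₁ (by omega)
      obtain ⟨s₂, hs₂, hv₂⟩ := ih _ _ _ h₂ (by omega)
      have key : ∀ x y : ℝ≥0∞, M * (r * (μ true * x + μ false * y)) =
          M * (r * μ true * x) + M * (r * μ false * y) := fun x y => by ring
      refine ⟨glueStrategy true fun b => if b then s₁ else s₂, ?_, fun g => ?_⟩
      · rw [ProtocolTree.scaledPay, T.expect_of_chance hT, key, childStrategy_glueStrategy,
          childStrategy_glueStrategy]
        refine (add_le_add hs₁ hs₂).trans_eq ?_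
        simp only [Prod.snd_add, Nat.cast_add]
        ring
      · rw [T.expect_of_chance hT, key, childStrategy_glueStrategy, childStrategy_glueStrategy,
          Entry.value_add]
        exact add_le_add (hv₁ g) (hv₂ g)
    · rw [roundMenu, hT] at he
      obtain rfl := Finset.mem_singleton.1 he
      refine ⟨fun _ => true, ?_, fun g => ?_⟩
      · rw [ProtocolTree.scaledPay, T.expect_of_leaf hT]
        refine (lt_roundDown_add_one M _ hlt).le.trans ?_
        simp only [Entry.single]
        gcongr
        exact one_le_pow_of_one_le' one_le_two _
      · rw [T.expect_of_leaf hT, Entry.value_single, ← mul_assoc]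
        gcongr
        exact roundDown_le _ _

/-! ### Revenue from the equal-revenue distribution -/

/-- A buyer with values `ε ^ i · q`, `i < ℓ`, and the (unnormalized) weights `ε ^ (-i)` pays little
if he cannot gain more than `γ ε ^ i` from imitating the next lower type or from opting out. -/
theorem sum_inv_pow_mul_pay_le {ε γ : ℝ} (hε : 0 < ε) (hε' : ε ≤ 1 / 2) (hγ : 0 ≤ γ) {ℓ : ℕ}
    (hℓ : 0 < ℓ) (q p : ℕ → ℝ) (hq : ∀ i, 0 ≤ q i ∧ q i ≤ 1)
    (hIC : ∀ i, i + 1 < ℓ → ε ^ i * q (i + 1) - p (i + 1) ≤ ε ^ i * q i - p i + γ * ε ^ i)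
    (hIR : ∀ i, i < ℓ → 0 ≤ ε ^ i * q i - p i + γ * ε ^ i) :
    ∑ i ∈ Finset.range ℓ, (ε ^ i)⁻¹ * p i ≤ 2 * (1 + ℓ * γ) := by
  set S : ℕ → ℝ := fun k => ∑ i ∈ Finset.range (k + 1), (ε ^ i)⁻¹ with hS
  -- The total weight of the scales up to `k`, times the scale `ε ^ k`. The recursion `w (k + 1) = 1
  -- + ε * w k` with `ε ≤ 1 / 2` keeps it increasing and between `1` and `2`.
  set w : ℕ → ℝ := fun k => ε ^ k * S k with hw
  have hSs : ∀ k, S (k + 1) = S k + (ε ^ (k + 1))⁻¹ := fun k => Finset.sum_range_succ _ _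
  have hws : ∀ k, w (k + 1) = 1 + ε * w k := by
    intro k
    have := pow_pos hε (k + 1)
    simp only [hw]
    rw [hSs, mul_add, mul_inv_cancel₀ this.ne', pow_succ]
    ring
  have hw0 : w 0 = 1 := by simp [hw, hS]
  have hwb : ∀ k, 1 ≤ w k ∧ w k ≤ 2 := by
    intro k
    induction k with
    | zero => rw [hw0]; norm_num
    | succ k ih => rw [hws]; constructor <;> nlinarith
  have hwm : ∀ k, w k ≤ w (k + 1) := by
    intro k
    induction k with
    | zero => rw [hw0]; exact (hwb 1).1
    | succ k ih => rw [hws (k + 1), hws k]; rw [hws k] at ih; nlinarith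
  have hSpos : ∀ k, 0 ≤ S k := fun k => Finset.sum_nonneg fun i _ => by positivity
  -- Summation by parts: multiplying `hIC k` by `S k` shifts the weight collected so far from `p k`
  -- to `p (k + 1)`. The term with `1 - q k` absorbs the growth of `w`. Individual rationality is
  -- needed only for the lowest type, at the end.
  have claim : ∀ k, k < ℓ → ∑ i ∈ Finset.range (k + 1), (ε ^ i)⁻¹ * p i ≤
      S k * p k + w k * (1 - q k) + 2 * k * γ := by
    intro k
    induction k with
    | zero =>
      intro _
      have := (hq 0).2
      simp [hw0, hS]
      linarith
    | succ k ih =>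
      intro hk
      have h1 := ih (by omega)
      rw [Finset.sum_range_succ, hSs]
      have h2 := mul_le_mul_of_nonneg_left (hIC k hk) (hSpos k)
      have h3 : S k * (ε ^ k * q (k + 1) - p (k + 1)) = w k * q (k + 1) - S k * p (k + 1) := by
        simp only [hw]; ring
      have h4 : S k * (ε ^ k * q k - p k + γ * ε ^ k) = w k * q k - S k * p k + γ * w k := by
        simp only [hw]; ring
      rw [h3, h4] at h2
      have h5 : w k * (1 - q (k + 1)) ≤ w (k + 1) * (1 - q (k + 1)) :=
        mul_le_mul_of_nonneg_right (hwm k) (by linarith [(hq (k + 1)).2])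
      have h6 : γ * w k ≤ γ * 2 := mul_le_mul_of_nonneg_left (hwb k).2 hγ
      push_cast
      linarith
  obtain ⟨k, rfl⟩ : ∃ k, ℓ = k + 1 := ⟨ℓ - 1, by omega⟩
  have h1 := claim k (by omega)
  have h2 := mul_le_mul_of_nonneg_left (hIR k (by omega)) (hSpos k)
  have h3 : S k * (ε ^ k * q k - p k + γ * ε ^ k) = w k * q k - S k * p k + γ * w k := by
    simp only [hw]; ring
  rw [h3] at h2
  have h6 : γ * w k ≤ γ * 2 := mul_le_mul_of_nonneg_left (hwb k).2 hγ
  have := (hwb k).2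
  push_cast
  linarith

/-- For a finite menu that contains a free entry: a bound `R x i` on the payment of a buyer of
kind `x` and scale `ε ^ i` who chooses an almost optimal entry, with small weighted sums. -/
theorem exists_payment_bound {V Y : Type*} (E : Finset V) (q : V → Y → ℝ) (p : V → ℝ)
    {ε γ : ℝ} (hε : 0 < ε) (hε' : ε ≤ 1 / 2) (hγ : 0 ≤ γ) {ℓ : ℕ} (hℓ : 0 < ℓ)
    (hq : ∀ e ∈ E, ∀ x, 0 ≤ q e x ∧ q e x ≤ 1) (hp : ∀ e ∈ E, 0 ≤ p e ∧ p e ≤ 3)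
    (hfree : ∃ e ∈ E, p e = 0) :
    ∃ R : Y → ℕ → ℝ, (∀ x i, 0 ≤ R x i ∧ R x i ≤ 3) ∧
      (∀ x i, ∀ e ∈ E,
        (∀ e' ∈ E, ε ^ i * q e' x - p e' ≤ ε ^ i * q e x - p e + γ * ε ^ i) → p e ≤ R x i) ∧
      ∀ x, ∑ i ∈ Finset.range ℓ, (ε ^ i)⁻¹ * R x i ≤ 2 * (1 + ℓ * γ) := by
  classical
  obtain ⟨e₀, he₀, hp₀⟩ := hfree
  have key : ∀ x i, ∃ a ∈ E,
      (∀ e' ∈ E, ε ^ i * q e' x - p e' ≤ ε ^ i * q a x - p a + γ * ε ^ i) ∧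
      ∀ e ∈ E, (∀ e' ∈ E, ε ^ i * q e' x - p e' ≤ ε ^ i * q e x - p e + γ * ε ^ i) →
        p e ≤ p a := by
    intro x i
    obtain ⟨b, hb, hbmax⟩ := Finset.exists_max_image E (fun e => ε ^ i * q e x - p e) ⟨e₀, he₀⟩
    -- Among the almost optimal entries take the most expensive one, so that the bound holds
    -- whichever of them is chosen.
    obtain ⟨a, ha, hamax⟩ := Finset.exists_max_image
      (E.filter fun e => ∀ e' ∈ E, ε ^ i * q e' x - p e' ≤ ε ^ i * q e x - p e + γ * ε ^ i) p
      ⟨b, Finset.mem_filter.2 ⟨hb, fun e' he' => (hbmax e' he').trans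
        (le_add_of_nonneg_right (by positivity))⟩⟩
    exact ⟨a, (Finset.mem_filter.1 ha).1, (Finset.mem_filter.1 ha).2, fun e he h =>
      hamax e (Finset.mem_filter.2 ⟨he, h⟩)⟩
  choose a ha hopt hmax using key
  refine ⟨fun x i => p (a x i), fun x i => hp _ (ha x i), hmax, fun x => ?_⟩
  refine sum_inv_pow_mul_pay_le hε hε' hγ hℓ (fun i => q (a x i) x) (fun i => p (a x i))
    (fun i => hq _ (ha x i) x) (fun i _ => hopt x i _ (ha x (i + 1))) fun i _ => ?_
  have h1 := hopt x i e₀ he₀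
  have h2 : 0 ≤ ε ^ i * q e₀ x := mul_nonneg (by positivity) (hq _ he₀ x).1
  rw [hp₀] at h1
  linarith

/-! ### Random scales -/

theorem sum_prod_apply {Y K : Type*} [Fintype Y] [DecidableEq Y] [Fintype K] (F : Y → K → ℝ) :
    ∑ f : Y → K, ∏ y, F y (f y) = ∏ y, ∑ i, F y i := by
  classical
  have := Finset.prod_univ_sum (fun _ : Y => (Finset.univ : Finset K)) F
  rw [Fintype.piFinset_univ] at this
  exact this.symm

/-- Draw the `f x` independently with law `p`. As `c ≤ 1`, no concentration of the total scale is
needed: it is at least half its mean with probability at least about half the mean of `c`, which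
exceeds the total failure probability of the events indexed by `N`. -/
theorem exists_scales {Y K J : Type*} [Fintype Y] [Fintype K] (N : Finset J)
    (p c : K → ℝ) (hp : ∀ i, 0 ≤ p i) (hp1 : ∑ i, p i = 1) (hc : ∀ i, 0 ≤ c i ∧ c i ≤ 1)
    (R : J → Y → K → ℝ) (hR : ∀ j ∈ N, ∀ x i, 0 ≤ R j x i ∧ R j x i ≤ 3) {m : ℝ}
    (hm : ∀ j ∈ N, ∀ x, ∑ i, p i * R j x i ≤ m) (hY : 0 < Fintype.card Y)
    (hN : N.card * Real.exp (-(m / 3 * Fintype.card Y)) < (∑ i, p i * c i) / 2) :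
    ∃ f : Y → K, (∑ i, p i * c i) / 2 * Fintype.card Y ≤ ∑ x, c (f x) ∧
      ∀ j ∈ N, ∑ x, R j x (f x) ≤ 3 * m * Fintype.card Y := by
  classical
  by_contra! hcon
  set Ec := ∑ i, p i * c i with hEc
  set y : ℝ := (Fintype.card Y : ℝ) with hy
  have hy0 : 0 < y := by rw [hy]; exact_mod_cast hY
  have hEc0 : 0 ≤ Ec := Finset.sum_nonneg fun i _ => mul_nonneg (hp i) (hc i).1
  -- Where the total scale is large, `hcon` provides a `j` whose exponential is at least `1`, and
  -- the total scale never exceeds `y`. Averaging this inequality merges the Chernoff bound, the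
  -- union bound and the bound on the scales.
  have point : ∀ f : Y → K, ∑ x, c (f x) ≤ Ec / 2 * y +
      y * ∑ j ∈ N, Real.exp (1 / 3 * (∑ x, R j x (f x)) - m * y) := by
    intro f
    have hexp : ∀ j ∈ N, 0 ≤ Real.exp (1 / 3 * (∑ x, R j x (f x)) - m * y) :=
      fun j _ => (Real.exp_pos _).le
    by_cases h : Ec / 2 * y ≤ ∑ x, c (f x)
    · obtain ⟨j, hj, hjR⟩ := hcon f h
      have h1 : 1 ≤ Real.exp (1 / 3 * (∑ x, R j x (f x)) - m * y) :=
        Real.one_le_exp (by linarith)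
      have h2 := h1.trans (Finset.single_le_sum hexp hj)
      have h3 : ∑ x, c (f x) ≤ y := by
        refine (Finset.sum_le_sum fun x _ => (hc (f x)).2).trans_eq ?_
        simp [hy]
      nlinarith [mul_nonneg hEc0 hy0.le]
    · have := mul_nonneg hy0.le (Finset.sum_nonneg hexp)
      linarith
  have hP : ∀ f : Y → K, 0 ≤ ∏ x, p (f x) := fun f => Finset.prod_nonneg fun x _ => hp _
  have h1 := Finset.sum_le_sum fun (f : Y → K) (_ : f ∈ Finset.univ) =>
    mul_le_mul_of_nonneg_left (point f) (hP f)
  have htot : ∑ f : Y → K, ∏ x, p (f x) = 1 := by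
    rw [sum_prod_apply fun _ => p]; simp [hp1]
  have hleft : ∑ f : Y → K, (∏ x, p (f x)) * ∑ x, c (f x) = y * Ec := by
    simp only [Finset.mul_sum]
    rw [Finset.sum_comm]
    have : ∀ x : Y, ∑ f : Y → K, (∏ x, p (f x)) * c (f x) = Ec := by
      intro x
      have e1 : ∀ f : Y → K, (∏ x, p (f x)) * c (f x) =
          ∏ z, p (f z) * if z = x then c (f z) else 1 := by
        intro f
        rw [Finset.prod_mul_distrib]
        simp
      simp only [e1]
      rw [sum_prod_apply fun z i => p i * if z = x then c i else 1]
      rw [Finset.prod_eq_single x]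
      · simp [hEc]
      · intro z _ hz
        simp [hz, hp1]
      · simp
    simp [this, hy]
  have hmean : ∀ j ∈ N, ∑ f : Y → K,
      (∏ x, p (f x)) * Real.exp (1 / 3 * (∑ x, R j x (f x)) - m * y) ≤
        Real.exp (-(m / 3 * y)) := by
    intro j hj
    have e1 : ∀ f : Y → K, (∏ x, p (f x)) * Real.exp (1 / 3 * (∑ x, R j x (f x)) - m * y) =
        Real.exp (-(m * y)) * ∏ x, p (f x) * Real.exp (1 / 3 * R j x (f x)) := by
      intro f
      rw [Finset.prod_mul_distrib, ← Real.exp_sum, ← Finset.mul_sum, sub_eq_add_neg, Real.exp_add]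
      ring
    simp only [e1]
    rw [← Finset.mul_sum, sum_prod_apply fun x i => p i * Real.exp (1 / 3 * R j x i)]
    -- The factor `1 / 3` brings `R` into `[0, 1]`, where `exp t ≤ 1 + 2 * t`.
    have e2 : ∀ x : Y, ∑ i, p i * Real.exp (1 / 3 * R j x i) ≤ Real.exp (2 / 3 * m) := by
      intro x
      have e3 : ∀ i, p i * Real.exp (1 / 3 * R j x i) ≤ p i + 2 / 3 * (p i * R j x i) := by
        intro i
        have hr := hR j hj x i
        have := exp_le_one_add_add_sq (t := 1 / 3 * R j x i) (by linarith) (by linarith)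
        have h5 : Real.exp (1 / 3 * R j x i) ≤ 1 + 2 / 3 * R j x i := by nlinarith
        nlinarith [mul_le_mul_of_nonneg_left h5 (hp i)]
      have e4 := Finset.sum_le_sum fun i (_ : i ∈ Finset.univ) => e3 i
      rw [Finset.sum_add_distrib, hp1, ← Finset.mul_sum] at e4
      have := hm j hj x
      have := Real.add_one_le_exp (2 / 3 * m)
      linarith
    have e5 : ∏ x : Y, ∑ i, p i * Real.exp (1 / 3 * R j x i) ≤ Real.exp (2 / 3 * m * y) := by
      refine (Finset.prod_le_prod (fun x _ => Finset.sum_nonneg fun i _ =>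
        mul_nonneg (hp i) (Real.exp_pos _).le) fun x _ => e2 x).trans_eq ?_
      rw [Finset.prod_const, Finset.card_univ, ← Real.exp_nat_mul, mul_comm]
    refine (mul_le_mul_of_nonneg_left e5 (Real.exp_pos _).le).trans_eq ?_
    rw [← Real.exp_add]
    congr 1
    ring
  have hright : ∑ f : Y → K, (∏ x, p (f x)) * (Ec / 2 * y +
      y * ∑ j ∈ N, Real.exp (1 / 3 * (∑ x, R j x (f x)) - m * y)) ≤
      Ec / 2 * y + y * (N.card * Real.exp (-(m / 3 * y))) := by
    simp only [mul_add, Finset.sum_add_distrib]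
    rw [← Finset.sum_mul, htot, one_mul]
    gcongr
    have e1 : ∀ f : Y → K, (∏ x, p (f x)) *
        (y * ∑ j ∈ N, Real.exp (1 / 3 * (∑ x, R j x (f x)) - m * y)) =
        y * ∑ j ∈ N, (∏ x, p (f x)) * Real.exp (1 / 3 * (∑ x, R j x (f x)) - m * y) := by
      intro f
      rw [← Finset.mul_sum]; ring
    simp only [e1]
    rw [← Finset.mul_sum, Finset.sum_comm]
    refine mul_le_mul_of_nonneg_left ?_ hy0.le
    rw [← nsmul_eq_mul]
    exact Finset.sum_le_card_nsmul _ _ _ hmean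
  rw [hleft] at h1
  have h2 := h1.trans hright
  have h3 := mul_lt_mul_of_pos_left hN hy0
  linarith

/-! ### Almost optimal entries of rounded menus -/

/-- The entries that can arise from an allocation of total probability at most one and from a
payment that was not truncated. -/
def validEntries (M : ℕ) (E : Finset (Entry n)) : Finset (Entry n) :=
  E.filter fun e => e.2 < 3 * M ∧ ∑ S, e.1 S ≤ M

theorem Entry.value_le (e : Entry n) {g : Finset (Fin n) → ℝ≥0∞} (hg : ∀ S, g S ≤ 1) :
    Entry.value e g ≤ ((∑ S, e.1 S : ℕ) : ℝ≥0∞) := by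
  rw [Entry.value, Nat.cast_sum]
  exact Finset.sum_le_sum fun S _ => by simpa using mul_le_mul_right (hg S) (e.1 S : ℝ≥0∞)

theorem ProtocolTree.IsFinite.expect_le_one {T : ProtocolTree n} (hT : T.IsFinite) (s : Strategy)
    {f : List Bool → Finset (Fin n) → ℝ≥0 → ℝ≥0∞} (hf : ∀ w S q, f w S q ≤ 1) :
    T.expect s f ≤ 1 :=
  (T.expect_mono s hf).trans_eq (hT s)

theorem ProtocolTree.mul_deepProb_le (T : ProtocolTree n) (h : ℕ) (s : Strategy) :
    h * T.deepProb h s ≤ T.expDepth s := by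
  rw [ProtocolTree.deepProb, ← ProtocolTree.expect_const_mul]
  refine T.expect_mono s fun w _ _ => ?_
  split_ifs with hw
  · rw [mul_one]; exact_mod_cast hw
  · simp

theorem ProtocolTree.IsFinite.sum_weights_le {T : ProtocolTree n} (hT : T.IsFinite) {s : Strategy}
    {M : ℕ} {e : Entry n} (he : ∀ g : Finset (Fin n) → ℝ≥0∞, (∀ S, g S ≤ 1) →
      Entry.value e g ≤ M * T.expect s fun _ S _ => g S) : ∑ S, e.1 S ≤ M := by
  have h1 := he (fun _ => 1) fun _ => le_rfl
  have h2 : (T.expect s fun _ _ _ => (1 : ℝ≥0∞)) = 1 := hT s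
  rw [h2, mul_one, Entry.value] at h1
  simp only [mul_one] at h1
  exact_mod_cast h1

/-- Rounding never raises a payment, so the strategy of opting out leaves a free entry, the outside
option that `exists_payment_bound` requires. -/
theorem exists_free_entry {T : ProtocolTree n} (hT : T.IsFinite) {κ : ℝ≥0∞}
    (hfree : ∃ s₀, T.scaledPay κ s₀ = 0) {M : ℕ} (hM : 0 < M) (h : ℕ) :
    ∃ e ∈ validEntries M (roundMenu M κ h 1 T), e.2 = 0 := by
  obtain ⟨s₀, h₀⟩ := hfree
  obtain ⟨e, he, hep, hev⟩ := roundMenu_approx M κ h 1 le_rfl T s₀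
  simp only [one_mul] at hep hev
  rw [h₀, mul_zero, nonpos_iff_eq_zero] at hep
  have hep' : e.2 = 0 := by exact_mod_cast hep
  exact ⟨e, Finset.mem_filter.2 ⟨he, by omega, hT.sum_weights_le fun g hg => (hev g hg).1⟩, hep'⟩

section

variable {T : ProtocolTree n} (hT : T.IsFinite) {κ : ℝ≥0∞} {g : Finset (Fin n) → ℝ≥0∞}
  (hg : ∀ S, g S ≤ 1) {c γ : ℝ≥0} {s : Strategy}
  (hfree : ∃ s₀, T.scaledPay κ s₀ = 0)
  (hIC : ∀ s', c * (T.expect s' fun _ S _ => g S) + T.scaledPay κ s ≤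
    c * (T.expect s fun _ S _ => g S) + T.scaledPay κ s' + ((γ * c : ℝ≥0) : ℝ≥0∞))

include hT hg hfree hIC in
-- Compared with opting out, the buyer pays at most his value plus the slack, each at most `1`.
-- Hence the cap `3` is never reached by a suggested strategy.
theorem scaledPay_le_two (hc : c ≤ 1) (hγ : γ ≤ 1) : T.scaledPay κ s ≤ 2 := by
  obtain ⟨s₀, h₀⟩ := hfree
  have h1 := le_add_self.trans (hIC s₀)
  rw [h₀, add_zero] at h1
  refine h1.trans ?_
  have h2 : (c : ℝ≥0∞) * (T.expect s fun _ S _ => g S) ≤ 1 :=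
    mul_le_one' (by exact_mod_cast hc) (hT.expect_le_one s fun _ S _ => hg S)
  have h3 : ((γ * c : ℝ≥0) : ℝ≥0∞) ≤ 1 := by exact_mod_cast mul_le_one' hγ hc
  exact (add_le_add h2 h3).trans_eq one_add_one_eq_two

include hT hg hfree hIC in
-- Round the suggested strategy to an entry `e`. A better entry `e'` would be attained by a
-- profitable deviation. Attaining `e` itself by a strategy and using incentive compatibility
-- against it shows that the true payment is hardly above that of `e`, although truncation may have
-- lowered the latter a lot. In `hγ'` the terms are the slack, the deep part, and the rounding of
-- values and of payments.
theorem exists_almost_optimal_entry (hc : c ≤ 1) (hγ : γ ≤ 1) {h m M : ℕ}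
    (hm : 0 < m) (hM : M = 2 ^ h * m) {η γ' : ℝ} (hdeep : (T.deepProb h s).toReal ≤ η)
    (hγ' : (γ : ℝ) * c + η * c + c / m + 1 / m ≤ γ' * c) :
    ∃ e ∈ validEntries M (roundMenu M κ h 1 T),
      (∀ e' ∈ validEntries M (roundMenu M κ h 1 T),
        (c : ℝ) * ((Entry.value e' g).toReal / M) - (e'.2 : ℝ) / M ≤
          c * ((Entry.value e g).toReal / M) - (e.2 : ℝ) / M + γ' * c) ∧
      (T.scaledPay κ s).toReal ≤ (e.2 : ℝ) / M + γ' * c := by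
  have hM0 : 0 < M := by rw [hM]; positivity
  have hMr : (0 : ℝ) < M := by exact_mod_cast hM0
  have hMt : (M : ℝ≥0∞) ≠ ⊤ := by simp
  have hpow : ((2 : ℝ) ^ h) / M = 1 / m := by
    rw [hM]; push_cast; field_simp
  set Q : Strategy → ℝ≥0∞ := fun s => T.expect s fun _ S _ => g S with hQ
  have hQ1 : ∀ s, Q s ≤ 1 := fun s => hT.expect_le_one s fun _ S _ => hg S
  have hQt : ∀ s, Q s ≠ ⊤ := fun s => ne_top_of_le_ne_top ENNReal.one_ne_top (hQ1 s)
  have hp2 := scaledPay_le_two hT hg hfree hIC hc hγ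
  have hpt : T.scaledPay κ s ≠ ⊤ := ne_top_of_le_ne_top (by simp) hp2
  have IC : ∀ s', T.scaledPay κ s' ≠ ⊤ → (c : ℝ) * (Q s').toReal + (T.scaledPay κ s).toReal ≤
      c * (Q s).toReal + (T.scaledPay κ s').toReal + γ * c := by
    intro s' hs'
    have h1 : c * Q s' + T.scaledPay κ s ≤
        c * Q s + T.scaledPay κ s' + ((γ * c : ℝ≥0) : ℝ≥0∞) := hIC s'
    have e1 : ∀ s, (c : ℝ≥0∞) * Q s ≠ ⊤ := fun s => ENNReal.mul_ne_top (by simp) (hQt s)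
    have e2 := ENNReal.add_ne_top.2 ⟨e1 s, hs'⟩
    have := ENNReal.toReal_mono (ENNReal.add_ne_top.2 ⟨e2, ENNReal.coe_ne_top⟩) h1
    rw [ENNReal.toReal_add (e1 s') hpt, ENNReal.toReal_add e2 ENNReal.coe_ne_top,
      ENNReal.toReal_add (e1 s) hs', ENNReal.toReal_mul, ENNReal.toReal_mul] at this
    simpa using this
  obtain ⟨e, he, hep, hev⟩ := roundMenu_approx M κ h 1 le_rfl T s
  simp only [one_mul] at hep hev
  have hdt : T.deepProb h s ≠ ⊤ := ne_top_of_le_ne_top ENNReal.one_ne_top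
    (hT.expect_le_one s fun w _ _ => by split_ifs <;> simp)
  have hval : ∀ (e : Entry n), Entry.value e g ≠ ⊤ := fun e =>
    ne_top_of_le_ne_top (ENNReal.natCast_ne_top _) (e.value_le hg)
  have hsum : ∑ S, e.1 S ≤ M := hT.sum_weights_le fun g hg => (hev g hg).1
  have hpe : (e.2 : ℝ) / M ≤ (T.scaledPay κ s).toReal := by
    rw [div_le_iff₀ hMr, mul_comm]
    have := ENNReal.toReal_mono (ENNReal.mul_ne_top hMt hpt) hep
    simpa using this
  have hcap : e.2 < 3 * M := by
    have h1 : (e.2 : ℝ≥0∞) ≤ M * 2 := hep.trans (mul_le_mul_right hp2 _)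
    have h2 : e.2 ≤ M * 2 := by exact_mod_cast h1
    omega
  have hQe : (Q s).toReal ≤ (Entry.value e g).toReal / M + 1 / m + η := by
    have h1 := ENNReal.toReal_mono (by
      simp [hval e, ENNReal.mul_ne_top hMt hdt]) (hev g hg).2
    rw [ENNReal.toReal_add (by simp [hval e]) (ENNReal.mul_ne_top hMt hdt),
      ENNReal.toReal_add (hval e) (by simp), ENNReal.toReal_mul, ENNReal.toReal_mul] at h1
    simp only [ENNReal.toReal_natCast, ENNReal.toReal_pow, ENNReal.toReal_ofNat] at h1
    have h2 : (Q s).toReal ≤ ((Entry.value e g).toReal + 2 ^ h + M * (T.deepProb h s).toReal) / M := by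
      rw [le_div_iff₀ hMr, mul_comm]; exact h1
    rw [add_div, add_div, hpow, mul_div_cancel_left₀ _ hMr.ne'] at h2
    linarith
  have hemem : e ∈ validEntries M (roundMenu M κ h 1 T) :=
    Finset.mem_filter.2 ⟨he, hcap, hsum⟩
  have attained : ∀ e' ∈ validEntries M (roundMenu M κ h 1 T), ∃ s',
      T.scaledPay κ s' ≠ ⊤ ∧ (T.scaledPay κ s').toReal ≤ (e'.2 : ℝ) / M + 1 / m ∧
        (Entry.value e' g).toReal / M ≤ (Q s').toReal := by
    intro e' he'
    obtain ⟨h1, h2, -⟩ := Finset.mem_filter.1 he'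
    obtain ⟨s', hs', hv'⟩ := roundMenu_attained M κ h 1 T e' h1 h2
    simp only [one_mul] at hs' hv'
    have hrt : (e'.2 : ℝ≥0∞) + 2 ^ h ≠ ⊤ := by simp
    refine ⟨s', ?_, ?_, ?_⟩
    · intro htop
      rw [htop, ENNReal.mul_top (by exact_mod_cast hM0.ne')] at hs'
      exact hrt (top_le_iff.1 hs')
    · have := ENNReal.toReal_mono hrt hs'
      rw [ENNReal.toReal_mul, ENNReal.toReal_add (by simp) (by simp)] at this
      simp only [ENNReal.toReal_natCast, ENNReal.toReal_pow, ENNReal.toReal_ofNat] at this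
      rw [← hpow, ← add_div, le_div_iff₀ hMr, mul_comm]
      exact this
    · have := ENNReal.toReal_mono (ENNReal.mul_ne_top hMt (hQt s')) (hv' g)
      rw [ENNReal.toReal_mul] at this
      rw [div_le_iff₀ hMr, mul_comm]
      simpa using this
  have hc0 : (0 : ℝ) ≤ c := c.2
  have hcQ := mul_le_mul_of_nonneg_left hQe hc0
  have hcm : (c : ℝ) * (1 / m) = c / m := by ring
  refine ⟨e, hemem, fun e' he' => ?_, ?_⟩
  · obtain ⟨s', ht, hp', hq'⟩ := attained e' he'
    have h1 := IC s' ht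
    have h2 := mul_le_mul_of_nonneg_left hq' hc0
    linarith
  · obtain ⟨s', ht, hp', hq'⟩ := attained e hemem
    have h1 := IC s' ht
    have h2 := mul_le_mul_of_nonneg_left hq' hc0
    linarith

end

/-! ### Scaled binary XOS valuations and the prior -/

theorem isXOS_scaledBxos (c : Finset (Finset (Fin n)) → ℝ≥0) {x : Finset (Finset (Fin n))}
    (hx : x.Nonempty) : IsXOS (scaledBxos c x) := by
  classical
  refine ⟨x.card, fun j i => if i ∈ (x.equivFin.symm j : Finset (Fin n)) then c x else 0,
    Finset.card_pos.2 hx, fun S => ?_⟩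
  have h1 : ∀ j : Fin x.card,
      (∑ i ∈ S, if i ∈ (x.equivFin.symm j : Finset (Fin n)) then c x else 0) =
        c x * (((x.equivFin.symm j : Finset (Fin n)) ∩ S).card : ℝ≥0) := by
    intro j
    rw [← Finset.sum_filter, Finset.sum_const, nsmul_eq_mul, mul_comm, Finset.inter_comm,
      Finset.filter_mem_eq_inter]
  simp only [h1]
  rw [scaledBxos, bxos]
  apply le_antisymm
  · obtain ⟨A, hA, hmax⟩ := Finset.exists_mem_eq_sup x hx fun A => (A ∩ S).card
    rw [hmax]
    refine le_trans ?_ (Finset.le_sup (Finset.mem_univ (x.equivFin ⟨A, hA⟩)))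
    simp
  · refine Finset.sup_le fun j _ => ?_
    gcongr
    exact Finset.le_sup (f := fun A => (A ∩ S).card) (x.equivFin.symm j).2

theorem bxos_le {x : Finset (Finset (Fin n))} {k : ℕ} (hx : ∀ A ∈ x, A.card = k)
    (S : Finset (Fin n)) : bxos x S ≤ k :=
  Finset.sup_le fun A hA => (Finset.card_le_card Finset.inter_subset_left).trans_eq (hx A hA)

theorem bxos_eq_of_mem {x : Finset (Finset (Fin n))} {k : ℕ} (hx : ∀ A ∈ x, A.card = k)
    {S A : Finset (Fin n)} (hA : A ∈ x) (hAS : A ⊆ S) : bxos x S = k := by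
  refine le_antisymm (bxos_le hx S) ?_
  have := Finset.le_sup (f := fun A => (A ∩ S).card) hA
  rwa [Finset.inter_eq_left.2 hAS, hx A hA] at this

theorem tsum_hardPrior {Y : Finset (Finset (Finset (Fin n)))} (hY : Y.Nonempty)
    (c : Finset (Finset (Fin n)) → ℝ≥0) (f : Valuation n → ℝ≥0∞) :
    ∑' v, hardPrior Y hY c v * f v = (Y.card : ℝ≥0∞)⁻¹ * ∑ x ∈ Y, f (scaledBxos c x) := by
  classical
  simp only [hardPrior, PMF.map_apply, ← ENNReal.tsum_mul_right]
  rw [ENNReal.tsum_comm]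
  trans ∑' x, PMF.uniformOfFinset Y hY x * f (scaledBxos c x)
  · refine tsum_congr fun x => ?_
    rw [tsum_eq_single (scaledBxos c x)]
    · simp
    · intro v hv
      simp [hv]
  rw [tsum_eq_sum (s := Y), Finset.mul_sum]
  · exact Finset.sum_congr rfl fun x hx => by rw [PMF.uniformOfFinset_apply_of_mem hY hx]
  · intro x hx
    rw [PMF.uniformOfFinset_apply_of_notMem hY hx, zero_mul]

theorem mem_support_hardPrior {Y : Finset (Finset (Finset (Fin n)))} (hY : Y.Nonempty)
    (c : Finset (Finset (Fin n)) → ℝ≥0) (v : Valuation n) :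
    v ∈ (hardPrior Y hY c).support ↔ ∃ x ∈ Y, scaledBxos c x = v := by
  simp [hardPrior, PMF.support_map]

/-- If the families in `Y` are nonempty, consist of sets of size `k` and are pairwise almost
disjoint in the sense of their binary XOS functions, then half of the welfare can be extracted. -/
theorem exists_mechanism {Y : Finset (Finset (Finset (Fin n)))} (hY : Y.Nonempty)
    (c : Finset (Finset (Fin n)) → ℝ≥0) {k : ℕ} (hne : ∀ x ∈ Y, x.Nonempty)
    (hk : ∀ x ∈ Y, ∀ A ∈ x, A.card = k)
    (hcross : ∀ x ∈ Y, ∀ y ∈ Y, x ≠ y → 2 * ∑ A ∈ y, bxos x A ≤ y.card * k) :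
    ∃ M : Mechanism n, M.IsTruthful (hardPrior Y hY c) ∧
      M.revenue (hardPrior Y hY c) =
        (Y.card : ℝ≥0∞)⁻¹ * ∑ x ∈ Y, ((c x * k / 2 : ℝ≥0) : ℝ≥0∞) := by
  classical
  have huniv : ∀ x ∈ Y, scaledBxos c x Finset.univ = c x * k := by
    intro x hx
    obtain ⟨A, hA⟩ := hne x hx
    rw [scaledBxos, bxos_eq_of_mem (hk x hx) hA (Finset.subset_univ _)]
  -- Several families may induce the same valuation; the lottery uses a chosen one of them, which
  -- has the same value for that type.
  let M : Mechanism n :=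
    { lottery := fun v => if h : ∃ x ∈ Y, scaledBxos c x = v then
        PMF.uniformOfFinset h.choose (hne _ h.choose_spec.1) else PMF.pure ∅
      pay := fun v => v Finset.univ / 2 }
  have hM : ∀ r, (∃ x ∈ Y, scaledBxos c x = r) → ∃ y ∈ Y, scaledBxos c y = r ∧
      ∀ v, M.expValue v r = (y.card : ℝ≥0∞)⁻¹ * ((∑ A ∈ y, v A : ℝ≥0) : ℝ≥0∞) := by
    intro r hr
    refine ⟨hr.choose, hr.choose_spec.1, hr.choose_spec.2, fun v => ?_⟩
    simp only [Mechanism.expValue, M, dif_pos hr, PMF.uniformOfFinset_apply, ite_mul, zero_mul]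
    rw [Finset.sum_ite_mem, Finset.univ_inter, ← Finset.mul_sum]
    push_cast
    rfl
  have hself : ∀ v, (∃ x ∈ Y, scaledBxos c x = v) → M.expValue v v = (v Finset.univ : ℝ≥0∞) := by
    intro v hv
    obtain ⟨y, hy, rfl, hval⟩ := hM v hv
    rw [hval, huniv y hy]
    have : ∑ A ∈ y, scaledBxos c y A = y.card * (c y * k) := by
      rw [← nsmul_eq_mul, ← Finset.sum_const]
      exact Finset.sum_congr rfl fun A hA => by
        rw [scaledBxos, bxos_eq_of_mem (hk y hy) hA subset_rfl]
    rw [this]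
    have h0 : (y.card : ℝ≥0∞) ≠ 0 := by
      exact_mod_cast (Finset.card_pos.2 (hne y hy)).ne'
    rw [ENNReal.coe_mul, ENNReal.coe_natCast, ← mul_assoc, ENNReal.inv_mul_cancel h0 (by simp),
      one_mul]
  have hhalf : ∀ v : Valuation n, (M.pay v : ℝ≥0∞) + M.pay v = v Finset.univ := by
    intro v
    rw [← ENNReal.coe_add]
    simp [M, add_halves]
  refine ⟨M, ⟨fun v hv r hr => ?_, fun v hv => ?_⟩, ?_⟩
  · rw [mem_support_hardPrior] at hv hr
    by_cases hvr : v = r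
    · rw [hvr]
    rw [hself v hv]
    obtain ⟨y, hy, hyr, hval⟩ := hM r hr
    obtain ⟨x, hx, rfl⟩ := hv
    have hxy : x ≠ y := by rintro rfl; exact hvr hyr
    have h1 : M.expValue (scaledBxos c x) r ≤ M.pay (scaledBxos c x) := by
      rw [hval]
      have h0 : (y.card : ℝ≥0∞) ≠ 0 := by
        exact_mod_cast (Finset.card_pos.2 (hne y hy)).ne'
      rw [mul_comm, ← div_eq_mul_inv, ENNReal.div_le_iff h0 (by simp)]
      have h2 : (∑ A ∈ y, scaledBxos c x A) ≤ M.pay (scaledBxos c x) * y.card := by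
        have h5 : M.pay (scaledBxos c x) = c x * k / 2 := by simp only [M, huniv x hx]
        rw [h5]
        simp only [scaledBxos]
        rw [← Finset.mul_sum]
        have h3 : (2 : ℝ≥0) * ∑ A ∈ y, (bxos x A : ℝ≥0) ≤ y.card * k := by
          exact_mod_cast hcross x hx y hy hxy
        have h4 : ∑ A ∈ y, (bxos x A : ℝ≥0) ≤ k / 2 * y.card := by
          rw [div_mul_eq_mul_div, le_div_iff₀ two_pos]
          linarith
        calc _ ≤ c x * (k / 2 * y.card) := by gcongr
          _ = _ := by ring
      exact_mod_cast h2
    calc _ ≤ (M.pay (scaledBxos c x) : ℝ≥0∞) + M.pay (scaledBxos c x) := by gcongr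
      _ = _ := hhalf _
      _ ≤ _ := le_self_add
  · rw [mem_support_hardPrior] at hv
    rw [hself v hv, ← hhalf v]
    exact le_self_add
  · rw [Mechanism.revenue, tsum_hardPrior hY c]
    congr 1
    exact Finset.sum_congr rfl fun x hx => by simp only [M, huniv x hx]

theorem exAnteComm_le_worstCaseComm (P : Protocol n) (D : PMF (Valuation n)) :
    P.exAnteComm D ≤ P.worstCaseComm := by
  calc P.exAnteComm D ≤ ∑' v, D v * P.worstCaseComm := by
        refine ENNReal.tsum_le_tsum fun v => ?_
        gcongr
        exact le_iSup (fun s => P.tree.expDepth s) _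
    _ = P.worstCaseComm := by rw [ENNReal.tsum_mul_right, D.tsum_coe, one_mul]

/-- Incentive compatibility for a type `scaledBxos c x`, in units of the size `k` of the sets in the
family `x`. -/
theorem Protocol.IsAlmostIC.scaled {P : Protocol n} {γ : ℝ≥0} {Y : Finset (Finset (Finset (Fin n)))}
    {hY : Y.Nonempty} {c : Finset (Finset (Fin n)) → ℝ≥0} (hP : P.IsAlmostIC γ (hardPrior Y hY c))
    {x : Finset (Finset (Fin n))} (hx : x ∈ Y) {k : ℕ} (hk0 : 0 < k)
    (hk : ∀ A ∈ x, A.card = k) (s : Strategy) :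
    c x * (P.tree.expect s fun _ S _ => (k : ℝ≥0∞)⁻¹ * bxos x S) +
        P.tree.scaledPay (k : ℝ≥0∞)⁻¹ (P.suggested (scaledBxos c x)) ≤
      c x * (P.tree.expect (P.suggested (scaledBxos c x)) fun _ S _ => (k : ℝ≥0∞)⁻¹ * bxos x S) +
        P.tree.scaledPay (k : ℝ≥0∞)⁻¹ s + ((γ * c x : ℝ≥0) : ℝ≥0∞) := by
  have h1 := hP.2.2 (scaledBxos c x) ((mem_support_hardPrior hY c _).2 ⟨x, hx, rfl⟩) s
  have hv : ∀ s, (k : ℝ≥0∞)⁻¹ * P.tree.expValue s (scaledBxos c x) =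
      c x * (P.tree.expect s fun _ S _ => (k : ℝ≥0∞)⁻¹ * bxos x S) := by
    intro s
    rw [ProtocolTree.expValue, ← ProtocolTree.expect_const_mul, ← ProtocolTree.expect_const_mul]
    congr 1
    funext w S q
    simp only [scaledBxos, ENNReal.coe_mul, ENNReal.coe_natCast]
    ring
  have hp : ∀ s, (k : ℝ≥0∞)⁻¹ * P.tree.expPay s = P.tree.scaledPay (k : ℝ≥0∞)⁻¹ s := by
    intro s
    rw [ProtocolTree.expPay, ← ProtocolTree.expect_const_mul]
    rfl
  have hk1 : (k : ℝ≥0∞) ≠ 0 := by exact_mod_cast hk0.ne'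
  have hu : (k : ℝ≥0∞)⁻¹ * ((γ * scaledBxos c x Finset.univ : ℝ≥0) : ℝ≥0∞) ≤
      ((γ * c x : ℝ≥0) : ℝ≥0∞) := by
    have : ((γ * scaledBxos c x Finset.univ : ℝ≥0) : ℝ≥0∞) ≤ k * ((γ * c x : ℝ≥0) : ℝ≥0∞) := by
      have h3 : (bxos x Finset.univ : ℝ≥0) ≤ k := by exact_mod_cast bxos_le hk _
      have : γ * scaledBxos c x Finset.univ ≤ k * (γ * c x) := by
        calc γ * scaledBxos c x Finset.univ ≤ γ * (c x * k) := by
              rw [scaledBxos]; gcongr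
          _ = _ := by ring
      exact_mod_cast this
    calc _ ≤ (k : ℝ≥0∞)⁻¹ * (k * ((γ * c x : ℝ≥0) : ℝ≥0∞)) := by gcongr
      _ = _ := by rw [← mul_assoc, ENNReal.inv_mul_cancel hk1 (by simp), one_mul]
  have h2 := mul_le_mul_right h1 (k : ℝ≥0∞)⁻¹
  rw [mul_add, mul_add, mul_add, hv, hv, hp, hp] at h2
  exact h2.trans (by gcongr)

/-- With `u = 2 ^ (α n)` and `h` of order `u`, the count is at most `exp (exp (b * u))`. On the
other side `x ≥ u ^ 2`, so `y ≥ exp (β₁ * u ^ 2)`, which wins because the exponent is quadratic in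
`u`. -/
theorem exists_depth {α β₀ β₁ K θ H : ℝ} (hα : 0 < α) (hαβ : 2 * α ≤ β₀) (hβ₁ : 0 < β₁)
    (hK : 0 < K) (hθ : 0 < θ) (hH : 0 < H) {m : ℕ} (hm : 0 < m) :
    ∃ n₀ : ℕ, ∀ n : ℕ, n₀ ≤ n → ∃ h : ℕ, 0 < h ∧ H * (2 : ℝ) ^ (α * (n : ℝ)) ≤ h ∧
      ∀ x y : ℝ, Real.exp (β₀ * n) ≤ x → Real.exp (β₁ * x) ≤ y →
        (((9 * (2 ^ n * (3 * (2 ^ h * m) + 1) ^ 2)) ^ 2 ^ h : ℕ) : ℝ) * Real.exp (-(K * y)) <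
          θ := by
  -- `a * u` bounds `9 + 2 * m + n + 2 * h`, which dominates the logarithm of the base; `b` also
  -- accounts for the power `2 ^ h`.
  set a : ℝ := 9 + 2 * m + 2 / α + 2 * (H + 1) with ha
  set b : ℝ := H + 1 + a with hb
  -- `u ≥ U` ensures both `(b + 1) * u ≤ β₁ * u ^ 2` and `2 + |log θ| ≤ K * u`.
  set U : ℝ := max ((b + 1) / β₁) ((2 + |Real.log θ|) / K) with hU
  refine ⟨⌈2 * U / α⌉₊, fun n hn => ?_⟩
  set u : ℝ := (2 : ℝ) ^ (α * (n : ℝ)) with hu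
  have hu1 : 1 ≤ u := Real.one_le_rpow (by norm_num) (by positivity)
  have hlog2 : (1 : ℝ) / 2 ≤ Real.log 2 := by linarith [Real.log_two_gt_d9]
  have hlog2' : Real.log 2 ≤ 1 := by linarith [Real.log_two_lt_d9]
  have hue : u = Real.exp (Real.log 2 * (α * n)) := by
    rw [hu, Real.rpow_def_of_pos two_pos]
  have hαn : 0 ≤ α * (n : ℝ) := by positivity
  have hun : α * n / 2 ≤ u := by
    have := Real.add_one_le_exp (Real.log 2 * (α * n))
    rw [← hue] at this
    nlinarith [mul_le_mul_of_nonneg_right hlog2 hαn]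
  have hUu : U ≤ u := by
    have h1 : 2 * U / α ≤ n := (Nat.le_ceil _).trans (by exact_mod_cast hn)
    rw [div_le_iff₀ hα] at h1
    linarith
  have hnu : (n : ℝ) ≤ 2 / α * u := by
    rw [div_mul_eq_mul_div, le_div_iff₀ hα]
    linarith
  have hHu : 0 < H * u := by positivity
  refine ⟨⌈H * u⌉₊, Nat.ceil_pos.2 hHu, Nat.le_ceil _, fun x y hx hy => ?_⟩
  set h := ⌈H * u⌉₊ with hh
  have hhu : (h : ℝ) ≤ (H + 1) * u := by
    have := (Nat.ceil_lt_add_one hHu.le).le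
    linarith
  -- the number of menus
  have hbase : (9 * (2 ^ n * (3 * (2 ^ h * m) + 1) ^ 2) : ℝ) ≤ Real.exp (a * u) := by
    have two_pow : ∀ k : ℕ, (2 : ℝ) ^ k ≤ Real.exp k := by
      intro k
      rw [← Real.exp_one_pow]
      exact pow_le_pow_left₀ (by norm_num) (by linarith [Real.add_one_le_exp (1 : ℝ)]) k
    have em : (3 * (2 ^ h * m) + 1 : ℝ) ≤ Real.exp (m + h + 1 / 2) * 4 := by
      have h1 : (m : ℝ) ≤ Real.exp m := by linarith [Real.add_one_le_exp (m : ℝ)]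
      have h2 : (2 : ℝ) ^ h * m ≤ Real.exp (m + h) := by
        rw [Real.exp_add, mul_comm]
        exact mul_le_mul h1 (two_pow h) (by positivity) (Real.exp_pos _).le
      have h3 : Real.exp (m + h) ≤ Real.exp (m + h + 1 / 2) := Real.exp_le_exp.2 (by linarith)
      have h4 : 1 ≤ Real.exp (m + h + 1 / 2 : ℝ) := Real.one_le_exp (by positivity)
      linarith
    have e144 : (9 : ℝ) * 16 ≤ Real.exp 8 := by
      have h1 : (2.7 : ℝ) ≤ Real.exp 1 := by linarith [Real.exp_one_gt_d9]
      have h2 : Real.exp 8 = Real.exp 1 ^ 8 := by rw [← Real.exp_nat_mul]; norm_num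
      rw [h2]
      calc (9 : ℝ) * 16 ≤ 2.7 ^ 8 := by norm_num
        _ ≤ _ := pow_le_pow_left₀ (by norm_num) h1 8
    calc (9 * (2 ^ n * (3 * (2 ^ h * m) + 1) ^ 2) : ℝ)
        ≤ 9 * (Real.exp n * (Real.exp (m + h + 1 / 2) * 4) ^ 2) := by
          gcongr
          exact two_pow n
      _ = 9 * 16 * Real.exp (n + 2 * (m + h + 1 / 2)) := by
          rw [mul_pow, ← Real.exp_nat_mul, Real.exp_add]
          push_cast
          ring_nf
      _ ≤ Real.exp 8 * Real.exp (n + 2 * (m + h + 1 / 2)) := by gcongr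
      _ = Real.exp (9 + 2 * m + n + 2 * h) := by rw [← Real.exp_add]; ring_nf
      _ ≤ Real.exp (a * u) := by
          apply Real.exp_le_exp.2
          have h1 : (9 + 2 * m : ℝ) ≤ (9 + 2 * m) * u := le_mul_of_one_le_right (by positivity) hu1
          rw [ha]
          linarith
  have ha0 : 0 < a := by positivity
  have hcount : (((9 * (2 ^ n * (3 * (2 ^ h * m) + 1) ^ 2)) ^ 2 ^ h : ℕ) : ℝ) ≤
      Real.exp (Real.exp (b * u)) := by
    push_cast
    refine (pow_le_pow_left₀ (by positivity) hbase _).trans ?_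
    rw [← Real.exp_nat_mul]
    apply Real.exp_le_exp.2
    push_cast
    have h1 : (2 : ℝ) ^ h ≤ Real.exp ((H + 1) * u) := by
      calc (2 : ℝ) ^ h ≤ Real.exp 1 ^ h :=
            pow_le_pow_left₀ (by norm_num) (by linarith [Real.add_one_le_exp (1 : ℝ)]) h
        _ = Real.exp h := Real.exp_one_pow h
        _ ≤ _ := Real.exp_le_exp.2 hhu
    have h2 : a * u ≤ Real.exp (a * u) := by linarith [Real.add_one_le_exp (a * u)]
    calc (2 : ℝ) ^ h * (a * u) ≤ Real.exp ((H + 1) * u) * Real.exp (a * u) :=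
          mul_le_mul h1 h2 (by positivity) (Real.exp_pos _).le
      _ = _ := by rw [← Real.exp_add, hb]; ring_nf
  -- the number of types
  have hux : u ^ 2 ≤ x := by
    refine le_trans ?_ hx
    rw [hue, ← Real.exp_nat_mul]
    apply Real.exp_le_exp.2
    push_cast
    nlinarith [mul_le_mul_of_nonneg_right hlog2' hαn,
      mul_le_mul_of_nonneg_right hαβ (Nat.cast_nonneg n : (0 : ℝ) ≤ n)]
  have hUb : (b + 1) / β₁ ≤ u := (le_max_left _ _).trans hUu
  have hUK : (2 + |Real.log θ|) / K ≤ u := (le_max_right _ _).trans hUu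
  rw [div_le_iff₀ hβ₁] at hUb
  rw [div_le_iff₀ hK] at hUK
  have hyu : Real.exp (b * u) * u ≤ y := by
    refine le_trans ?_ hy
    have h1 : u ≤ Real.exp u := by linarith [Real.add_one_le_exp u]
    calc Real.exp (b * u) * u ≤ Real.exp (b * u) * Real.exp u := by gcongr
      _ = Real.exp ((b + 1) * u) := by rw [← Real.exp_add]; ring_nf
      _ ≤ Real.exp (β₁ * x) := by
        apply Real.exp_le_exp.2
        nlinarith
  calc _ ≤ Real.exp (Real.exp (b * u)) * Real.exp (-(K * y)) := by gcongr
    _ = Real.exp (Real.exp (b * u) - K * y) := by rw [← Real.exp_add]; ring_nf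
    _ < θ := by
      rw [← Real.lt_log_iff_exp_lt hθ]
      have hb0 : 0 < b := by positivity
      have h1 : 1 ≤ Real.exp (b * u) := Real.one_le_exp (by positivity)
      have h2 := neg_abs_le (Real.log θ)
      have h3 := mul_le_mul_of_nonneg_left hyu hK.le
      have h4 := mul_le_mul_of_nonneg_left hUK (Real.exp_pos (b * u)).le
      have h5 := abs_nonneg (Real.log θ)
      nlinarith [mul_le_mul_of_nonneg_right h1 h5]

/-- Families in a design whose ground set is itself a design have small cross values. -/
theorem two_mul_sum_bxos_le {n q₀ q₁ : ℕ} (hq₀ : 16 ≤ q₀) (hq₁ : 16 ≤ q₁) {δ₀ δ₁ : ℝ}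
    (hδ₀ : δ₀ ≤ 1) (hδ₁ : δ₁ ≤ 1) {X : Finset (Finset (Fin n))}
    {Y : Finset (Finset (Finset (Fin n)))}
    (hX : IsDesign (Finset.univ : Finset (Fin n)) (1 / q₀) δ₀ X) (hY : IsDesign X (1 / q₁) δ₁ Y)
    (hn : q₀ ≤ n) (hXc : q₁ ≤ X.card) :
    ∀ x ∈ Y, ∀ y ∈ Y, x ≠ y → 2 * ∑ A ∈ y, bxos x A ≤ y.card * (n / q₀) := by
  intro x hx y hy hxy
  have half : ∀ {q N : ℕ}, 16 ≤ q → q ≤ N → (N : ℝ) / q ≤ 2 * ((N / q : ℕ) : ℝ) := by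
    intro q N hq hN
    have e1 : N < (N / q + 1) * q :=
      (Nat.div_lt_iff_lt_mul (by omega)).1 (Nat.lt_succ_self _)
    have e2 : 1 ≤ N / q := (Nat.le_div_iff_mul_le (by omega)).2 (by omega)
    rw [div_le_iff₀ (by positivity)]
    have : N ≤ 2 * (N / q) * q := by nlinarith
    exact_mod_cast this
  -- Here `16 = 4 * 2 * 2`: a quarter is wanted, `1 + δ ≤ 2`, and the floor costs another factor
  -- `2`.
  have inter : ∀ {q N : ℕ} {δ t : ℝ}, 16 ≤ q → q ≤ N → δ ≤ 1 →
      t ≤ (1 + δ) * (1 / (q : ℝ)) ^ 2 * (N : ℝ) → 4 * t ≤ ((N / q : ℕ) : ℝ) := by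
    intro q N δ t hq hN hδ ht
    have hq0 : (0 : ℝ) < q := by positivity
    have hq16 : (16 : ℝ) ≤ q := by exact_mod_cast hq
    have h1 := half hq hN
    have h2 : (1 + δ) * (1 / (q : ℝ)) ^ 2 * (N : ℝ) ≤ 2 * (1 / (q : ℝ)) ^ 2 * (N : ℝ) := by
      gcongr; linarith
    have h3 : 2 * (1 / (q : ℝ)) ^ 2 * (N : ℝ) = 2 * (N / q) / q := by field_simp
    have h4 : 2 * ((N : ℝ) / q) / q ≤ 2 * (2 * ((N / q : ℕ) : ℝ)) / 16 := by gcongr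
    linarith
  have card0 : ∀ A ∈ X, A.card = n / q₀ := by
    intro A hA
    rw [hX.card_eq A hA, Finset.card_univ, Fintype.card_fin, one_div_mul_eq_div,
      Nat.floor_div_natCast, Nat.floor_natCast]
  have card1 : y.card = X.card / q₁ := by
    rw [hY.card_eq y hy, one_div_mul_eq_div, Nat.floor_div_natCast, Nat.floor_natCast]
  have hin : 4 * (x ∩ y).card ≤ y.card := by
    have := inter hq₁ hXc hδ₁ (hY.inter_le x hx y hy hxy)
    rw [card1]
    exact_mod_cast this
  have hout : ∀ A ∈ y \ x, 4 * bxos x A ≤ n / q₀ := by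
    intro A hA
    obtain ⟨hAy, hAx⟩ := Finset.mem_sdiff.1 hA
    have : bxos x A ≤ n / q₀ / 4 := by
      refine Finset.sup_le fun B hB => ?_
      have hBA : B ≠ A := by rintro rfl; exact hAx hB
      have h1 := hX.inter_le B (hY.subset x hx hB) A (hY.subset y hy hAy) hBA
      rw [Finset.card_univ, Fintype.card_fin] at h1
      have h2 := inter hq₀ hn hδ₀ h1
      rw [Nat.le_div_iff_mul_le (by norm_num)]
      have : 4 * (B ∩ A).card ≤ n / q₀ := by exact_mod_cast h2
      omega
    omega
  have hxX : ∀ A ∈ x, A.card = n / q₀ := fun A hA => card0 A (hY.subset x hx hA)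
  have h1 : 4 * ∑ A ∈ y ∩ x, bxos x A ≤ y.card * (n / q₀) := by
    calc 4 * ∑ A ∈ y ∩ x, bxos x A ≤ 4 * ((y ∩ x).card • (n / q₀)) := by
          gcongr
          exact Finset.sum_le_card_nsmul _ _ _ fun A _ => bxos_le hxX A
      _ = 4 * (x ∩ y).card * (n / q₀) := by rw [Finset.inter_comm, smul_eq_mul]; ring
      _ ≤ _ := by gcongr
  have h2 : 4 * ∑ A ∈ y \ x, bxos x A ≤ y.card * (n / q₀) := by
    rw [Finset.mul_sum]
    refine (Finset.sum_le_card_nsmul _ _ _ hout).trans ?_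
    rw [smul_eq_mul]
    gcongr
    exact Finset.sdiff_subset
  rw [← Finset.sum_inter_add_sum_sdiff y x]
  omega

theorem ProtocolTree.scaledPay_eq (T : ProtocolTree n) (κ : ℝ≥0∞) (s : Strategy) :
    T.scaledPay κ s = κ * T.expPay s := by
  rw [ProtocolTree.expPay, ← ProtocolTree.expect_const_mul]
  rfl

/-! ### Depth, revenue and payments summed over the types -/

section

variable {P : Protocol n} {Y : Finset (Finset (Finset (Fin n)))} {hY : Y.Nonempty}
  {c : Finset (Finset (Fin n)) → ℝ≥0}

theorem sum_expDepth_le {u : ℝ} (hu : 0 ≤ u)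
    (h : P.exAnteComm (hardPrior Y hY c) < ENNReal.ofReal u) :
    (∀ x ∈ Y, P.tree.expDepth (P.suggested (scaledBxos c x)) ≠ ⊤) ∧
      ∑ x ∈ Y, (P.tree.expDepth (P.suggested (scaledBxos c x))).toReal ≤ Y.card * u := by
  rw [Protocol.exAnteComm,
    tsum_hardPrior hY c fun v => P.tree.expDepth (P.suggested v)] at h
  have h0 : (Y.card : ℝ≥0∞) ≠ 0 := by exact_mod_cast (Finset.card_pos.2 hY).ne'
  have h1 : ∑ x ∈ Y, P.tree.expDepth (P.suggested (scaledBxos c x)) ≤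
      Y.card * ENNReal.ofReal u := by
    calc _ = (Y.card : ℝ≥0∞) * ((Y.card : ℝ≥0∞)⁻¹ *
          ∑ x ∈ Y, P.tree.expDepth (P.suggested (scaledBxos c x))) := by
          rw [← mul_assoc, ENNReal.mul_inv_cancel h0 (by simp), one_mul]
      _ ≤ _ := by gcongr
  have ht : (Y.card : ℝ≥0∞) * ENNReal.ofReal u ≠ ⊤ := ENNReal.mul_ne_top (by simp) (by simp)
  have h2 : ∀ x ∈ Y, P.tree.expDepth (P.suggested (scaledBxos c x)) ≠ ⊤ := fun x hx =>
    ne_top_of_le_ne_top ht ((Finset.single_le_sum (fun _ _ => zero_le) hx).trans h1)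
  refine ⟨h2, ?_⟩
  have := ENNReal.toReal_mono ht h1
  rw [ENNReal.toReal_sum h2, ENNReal.toReal_mul, ENNReal.toReal_ofReal hu] at this
  simpa using this

/-- Approximate optimality is tested against the mechanism that extracts half of the full value;
multiplying by `|Y| / k` removes the uniform weights and the unit. -/
theorem sum_scale_le_sum_scaledPay {k : ℕ} (hk0 : 0 < k) (hne : ∀ x ∈ Y, x.Nonempty)
    (hk : ∀ x ∈ Y, ∀ A ∈ x, A.card = k)
    (hcross : ∀ x ∈ Y, ∀ y ∈ Y, x ≠ y → 2 * ∑ A ∈ y, bxos x A ≤ y.card * k)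
    {τ : ℝ} (hτ : 0 ≤ τ) (hP : P.IsApproxOptimal τ (hardPrior Y hY c))
    (hfin : ∀ x ∈ Y, P.tree.scaledPay (k : ℝ≥0∞)⁻¹ (P.suggested (scaledBxos c x)) ≠ ⊤) :
    τ / 2 * ∑ x ∈ Y, (c x : ℝ) ≤
      ∑ x ∈ Y, (P.tree.scaledPay (k : ℝ≥0∞)⁻¹ (P.suggested (scaledBxos c x))).toReal := by
  obtain ⟨M, hM, hrev⟩ := exists_mechanism hY c hne hk hcross
  have h1 := hP M hM
  rw [hrev, Protocol.revenue, tsum_hardPrior hY c fun v => P.tree.expPay (P.suggested v)] at h1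
  have h0 : (Y.card : ℝ≥0∞) ≠ 0 := by exact_mod_cast (Finset.card_pos.2 hY).ne'
  have h2 := mul_le_mul_right h1 ((k : ℝ≥0∞)⁻¹ * Y.card)
  have e1 : ∀ a : ℝ≥0∞, (k : ℝ≥0∞)⁻¹ * Y.card * ((Y.card : ℝ≥0∞)⁻¹ * a) = (k : ℝ≥0∞)⁻¹ * a := by
    intro a
    rw [mul_assoc, ← mul_assoc (Y.card : ℝ≥0∞), ENNReal.mul_inv_cancel h0 (by simp), one_mul]
  have e2 : (k : ℝ≥0∞)⁻¹ * ∑ x ∈ Y, P.tree.expPay (P.suggested (scaledBxos c x)) =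
      ∑ x ∈ Y, P.tree.scaledPay (k : ℝ≥0∞)⁻¹ (P.suggested (scaledBxos c x)) := by
    rw [Finset.mul_sum]
    simp only [ProtocolTree.scaledPay_eq]
  rw [mul_left_comm (ENNReal.ofReal τ), e1, e1, e2, mul_left_comm] at h2
  have h3 := ENNReal.toReal_mono (ENNReal.sum_ne_top.2 hfin) h2
  rw [ENNReal.toReal_sum hfin, ENNReal.toReal_mul, ENNReal.toReal_mul,
    ENNReal.toReal_ofReal hτ, ENNReal.toReal_sum fun _ _ => ENNReal.coe_ne_top] at h3
  refine le_trans (le_of_eq ?_) h3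
  have hk2 : (k : ℝ) ≠ 0 := by exact_mod_cast hk0.ne'
  simp only [ENNReal.toReal_inv, ENNReal.toReal_natCast, ENNReal.coe_toReal, NNReal.coe_div,
    NNReal.coe_mul, NNReal.coe_natCast, NNReal.coe_ofNat]
  rw [← Finset.sum_div, ← Finset.sum_mul]
  field_simp

/-- The payment of a type whose scale is `c x`, in terms of a bound for the rounded menu. -/
theorem scaledPay_le {γ : ℝ≥0} (hP : P.IsAlmostIC γ (hardPrior Y hY c))
    {x : Finset (Finset (Fin n))} (hx : x ∈ Y) {k : ℕ} (hk0 : 0 < k) (hk : ∀ A ∈ x, A.card = k)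
    (hc : c x ≤ 1) (hγ : γ ≤ 1) :
    P.tree.scaledPay (k : ℝ≥0∞)⁻¹ (P.suggested (scaledBxos c x)) ≤ 2 ∧
    (∀ {M : ℕ}, 0 < M → ∀ h, ∃ e ∈ validEntries M (roundMenu M (k : ℝ≥0∞)⁻¹ h 1 P.tree), e.2 = 0) ∧
    ∀ {h m M : ℕ} {η γ' ρ : ℝ}, 0 < h → 0 < m → M = 2 ^ h * m → 0 < η → 0 ≤ γ' → 0 ≤ ρ →
      (γ : ℝ) * c x + η * c x + c x / m + 1 / m ≤ γ' * c x →
      P.tree.expDepth (P.suggested (scaledBxos c x)) ≠ ⊤ →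
      (∀ e ∈ validEntries M (roundMenu M (k : ℝ≥0∞)⁻¹ h 1 P.tree),
        (∀ e' ∈ validEntries M (roundMenu M (k : ℝ≥0∞)⁻¹ h 1 P.tree),
          (c x : ℝ) * ((Entry.value e' fun S => (k : ℝ≥0∞)⁻¹ * bxos x S).toReal / M) -
            (e'.2 : ℝ) / M ≤
          c x * ((Entry.value e fun S => (k : ℝ≥0∞)⁻¹ * bxos x S).toReal / M) - (e.2 : ℝ) / M +
            γ' * c x) → (e.2 : ℝ) / M ≤ ρ) →
      (P.tree.scaledPay (k : ℝ≥0∞)⁻¹ (P.suggested (scaledBxos c x))).toReal ≤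
        ρ + γ' + 2 / (η * h) * (P.tree.expDepth (P.suggested (scaledBxos c x))).toReal := by
  have hk1 : (k : ℝ≥0∞) ≠ 0 := by exact_mod_cast hk0.ne'
  have hg : ∀ S, (k : ℝ≥0∞)⁻¹ * bxos x S ≤ 1 := by
    intro S
    calc (k : ℝ≥0∞)⁻¹ * bxos x S ≤ (k : ℝ≥0∞)⁻¹ * k := by
          gcongr
          exact_mod_cast bxos_le hk S
      _ = 1 := ENNReal.inv_mul_cancel hk1 (by simp)
  obtain ⟨s₀, h₀, -⟩ := hP.2.1
  have hfree₀ : P.tree.scaledPay (k : ℝ≥0∞)⁻¹ s₀ = 0 := by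
    rw [ProtocolTree.scaledPay_eq, h₀, mul_zero]
  have hfree : ∃ s₀, P.tree.scaledPay (k : ℝ≥0∞)⁻¹ s₀ = 0 := ⟨s₀, hfree₀⟩
  have hIC := hP.scaled hx hk0 hk
  have htwo := scaledPay_le_two hP.1 hg hfree hIC hc hγ
  refine ⟨htwo, fun hM h => exists_free_entry hP.1 hfree hM h, ?_⟩
  · intro h m M η γ' ρ hh hm hM hη hγ0 hρ hγ' hD hbound
    have hh' : (0 : ℝ) < h := by exact_mod_cast hh
    have hc1 : (c x : ℝ) ≤ 1 := by exact_mod_cast hc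
    have hγc : γ' * c x ≤ γ' := mul_le_of_le_one_right hγ0 hc1
    set D := P.tree.expDepth (P.suggested (scaledBxos c x))
    have hD0 : 0 ≤ 2 / (η * h) * D.toReal := by positivity
    -- A type that rarely goes deep is covered by the rounded menu. Otherwise its expected depth is
    -- at least `η * h` by Markov, and its payment, at most `2`, is charged to that depth.
    by_cases hdeep : (P.tree.deepProb h (P.suggested (scaledBxos c x))).toReal ≤ η
    · obtain ⟨e, he, hopt, hpay⟩ :=
        exists_almost_optimal_entry hP.1 hg hfree hIC hc hγ hm hM hdeep hγ'
      have := hbound e he hopt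
      linarith
    · have h1 := ENNReal.toReal_mono hD
        (P.tree.mul_deepProb_le h (P.suggested (scaledBxos c x)))
      rw [ENNReal.toReal_mul, ENNReal.toReal_natCast] at h1
      have h2 : η * h ≤ D.toReal := by
        push Not at hdeep
        nlinarith
      have h3 : 2 ≤ 2 / (η * h) * D.toReal := by
        rw [div_mul_eq_mul_div, le_div_iff₀ (by positivity)]
        linarith
      have h4 := ENNReal.toReal_mono (by simp) htwo
      rw [ENNReal.toReal_ofNat] at h4
      linarith

end

/-- The union bound runs over all rounded menus with a free entry. The payment bound `R` for a menu
is defined for every scale before the scales are drawn, which is why the draws are independent of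
it. Since `ℓ * γ' ≤ 1`, its mean is at most `4 / Z`. -/
theorem exists_hard_scales {Y : Finset (Finset (Finset (Fin n)))} (hY : Y.Nonempty) {k : ℕ}
    (hk0 : 0 < k) (hk : ∀ x ∈ Y, ∀ A ∈ x, A.card = k) {e : ℝ≥0} (he0 : 0 < e) (he : e ≤ 1 / 2)
    {ℓ : ℕ} (hℓ : 0 < ℓ) {Z : ℝ} (hZ : Z = ∑ i ∈ Finset.range ℓ, ((e : ℝ) ^ i)⁻¹) {γ' : ℝ}
    (hγ' : 0 ≤ γ') (hγℓ : ℓ * γ' ≤ 1) {M h : ℕ} (hM : 0 < M)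
    (hcount : ((menuClass n M h).card : ℝ) * Real.exp (-(4 / (3 * Z) * Y.card)) < ℓ / (2 * Z)) :
    ∃ c : Finset (Finset (Fin n)) → ℝ≥0,
      (∀ x ∈ Y, ∃ i < ℓ, c x = e ^ i) ∧
      ℓ / (2 * Z) * Y.card ≤ ∑ x ∈ Y, (c x : ℝ) ∧
      ∀ E ∈ menuClass n M h, (∃ a ∈ validEntries M E, a.2 = 0) →
        ∃ ρ : Finset (Finset (Fin n)) → ℝ, (∀ x, 0 ≤ ρ x) ∧
          ∑ x ∈ Y, ρ x ≤ 12 / Z * Y.card ∧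
          ∀ x ∈ Y, ∀ a ∈ validEntries M E, (∀ a' ∈ validEntries M E,
            (c x : ℝ) * ((Entry.value a' fun S => (k : ℝ≥0∞)⁻¹ * bxos x S).toReal / M) -
              (a'.2 : ℝ) / M ≤
            c x * ((Entry.value a fun S => (k : ℝ≥0∞)⁻¹ * bxos x S).toReal / M) - (a.2 : ℝ) / M +
              γ' * c x) → (a.2 : ℝ) / M ≤ ρ x := by
  classical
  have hMr : (0 : ℝ) < M := by exact_mod_cast hM
  have her : (0 : ℝ) < e := by exact_mod_cast he0
  have her' : (e : ℝ) ≤ 1 / 2 := by exact_mod_cast he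
  have hZ0 : 0 < Z := by
    rw [hZ]
    exact Finset.sum_pos (fun i _ => by positivity) ⟨0, Finset.mem_range.2 hℓ⟩
  have hk1 : (k : ℝ≥0∞) ≠ 0 := by exact_mod_cast hk0.ne'
  have hg : ∀ x ∈ Y, ∀ S, (k : ℝ≥0∞)⁻¹ * bxos x S ≤ 1 := by
    intro x hx S
    calc (k : ℝ≥0∞)⁻¹ * bxos x S ≤ (k : ℝ≥0∞)⁻¹ * k := by
          gcongr
          exact_mod_cast bxos_le (hk x hx) S
      _ = 1 := ENNReal.inv_mul_cancel hk1 (by simp)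
  let N := (menuClass n M h).filter fun E => ∃ a ∈ validEntries M E, a.2 = 0
  have hbound : ∀ E ∈ N, ∃ R : Y → ℕ → ℝ, (∀ x i, 0 ≤ R x i ∧ R x i ≤ 3) ∧
      (∀ (x : Y) i, ∀ a ∈ validEntries M E, (∀ a' ∈ validEntries M E,
        (e : ℝ) ^ i * ((Entry.value a' fun S => (k : ℝ≥0∞)⁻¹ * bxos (x : Finset _) S).toReal / M) -
            (a'.2 : ℝ) / M ≤
          (e : ℝ) ^ i * ((Entry.value a fun S => (k : ℝ≥0∞)⁻¹ * bxos (x : Finset _) S).toReal / M) -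
            (a.2 : ℝ) / M + γ' * (e : ℝ) ^ i) → (a.2 : ℝ) / M ≤ R x i) ∧
      ∀ x, ∑ i ∈ Finset.range ℓ, ((e : ℝ) ^ i)⁻¹ * R x i ≤ 2 * (1 + ℓ * γ') := by
    intro E hE
    obtain ⟨a₀, ha₀, hfree⟩ := (Finset.mem_filter.1 hE).2
    refine exists_payment_bound (validEntries M E)
      (fun a (x : Y) => (Entry.value a fun S => (k : ℝ≥0∞)⁻¹ * bxos (x : Finset _) S).toReal / M)
      (fun a => (a.2 : ℝ) / M) her her' hγ' hℓ ?_ ?_ ⟨a₀, ha₀, by simp [hfree]⟩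
    · intro a ha x
      obtain ⟨-, -, h2⟩ := Finset.mem_filter.1 ha
      refine ⟨by positivity, ?_⟩
      rw [div_le_one hMr]
      have h3 := ENNReal.toReal_mono (ENNReal.natCast_ne_top _) (a.value_le (hg x x.2))
      rw [ENNReal.toReal_natCast] at h3
      exact h3.trans (by exact_mod_cast h2)
    · intro a ha
      obtain ⟨-, h1, -⟩ := Finset.mem_filter.1 ha
      refine ⟨by positivity, ?_⟩
      rw [div_le_iff₀ hMr]
      exact_mod_cast h1.le
  choose! R hR hRopt hRsum using hbound
  have hsumZ : ∑ i : Fin ℓ, ((e : ℝ) ^ (i : ℕ))⁻¹ / Z = 1 := by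
    rw [← Finset.sum_div, Fin.sum_univ_eq_sum_range fun i => ((e : ℝ) ^ i)⁻¹, ← hZ,
      div_self hZ0.ne']
  have hEc : ∑ i : Fin ℓ, ((e : ℝ) ^ (i : ℕ))⁻¹ / Z * (e : ℝ) ^ (i : ℕ) = ℓ / Z := by
    have : ∀ i : Fin ℓ, ((e : ℝ) ^ (i : ℕ))⁻¹ / Z * (e : ℝ) ^ (i : ℕ) = 1 / Z := by
      intro i
      have := pow_pos her (i : ℕ)
      field_simp
    simp only [this, Finset.sum_const, Finset.card_univ, Fintype.card_fin, nsmul_eq_mul]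
    ring
  have hNcard : (N.card : ℝ) ≤ (menuClass n M h).card := by
    exact_mod_cast Finset.card_filter_le _ _
  obtain ⟨f, hf, hfR⟩ := exists_scales (Y := Y) (K := Fin ℓ) N
    (fun i => ((e : ℝ) ^ (i : ℕ))⁻¹ / Z) (fun i => (e : ℝ) ^ (i : ℕ))
    (fun i => by positivity) hsumZ
    (fun i => ⟨by positivity, pow_le_one₀ her.le (by linarith)⟩)
    (fun E x i => R E x i) (fun E hE x i => hR E hE x i) (m := 4 / Z)
    (fun E hE x => by
      have h1 := hRsum E hE x
      have h2 : ∑ i : Fin ℓ, ((e : ℝ) ^ (i : ℕ))⁻¹ / Z * R E x i =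
          (∑ i ∈ Finset.range ℓ, ((e : ℝ) ^ i)⁻¹ * R E x i) / Z := by
        rw [← Fin.sum_univ_eq_sum_range fun i => ((e : ℝ) ^ i)⁻¹ * R E x i, Finset.sum_div]
        exact Finset.sum_congr rfl fun i _ => by ring
      rw [h2]
      gcongr
      linarith)
    (by simpa using hY.card_pos)
    (by
      rw [hEc, Fintype.card_coe]
      calc (N.card : ℝ) * Real.exp (-(4 / Z / 3 * Y.card)) ≤
          (menuClass n M h).card * Real.exp (-(4 / (3 * Z) * Y.card)) := by
            rw [div_div, mul_comm Z 3]
            gcongr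
        _ < ℓ / (2 * Z) := hcount
        _ = _ := by field_simp)
  rw [hEc, Fintype.card_coe] at hf
  have hcx : ∀ x (hx : x ∈ Y), (if h : x ∈ Y then e ^ (f ⟨x, h⟩ : ℕ) else 0) =
      e ^ (f ⟨x, hx⟩ : ℕ) := fun x hx => dif_pos hx
  refine ⟨fun x => if h : x ∈ Y then e ^ (f ⟨x, h⟩ : ℕ) else 0,
    fun x hx => ⟨f ⟨x, hx⟩, (f ⟨x, hx⟩).2, hcx x hx⟩, ?_, fun E hE hfree => ?_⟩
  · rw [← Finset.sum_coe_sort]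
    refine le_trans (le_of_eq (by field_simp)) (hf.trans_eq ?_)
    exact Finset.sum_congr rfl fun x _ => by dsimp only; rw [hcx x x.2]; simp
  · have hEN : E ∈ N := Finset.mem_filter.2 ⟨hE, hfree⟩
    refine ⟨fun x => if h : x ∈ Y then R E ⟨x, h⟩ (f ⟨x, h⟩) else 0, fun x => ?_, ?_, ?_⟩
    · dsimp only
      split_ifs with hx
      · exact (hR E hEN _ _).1
      · exact le_rfl
    · have h1 := hfR E hEN
      rw [Fintype.card_coe] at h1
      rw [← Finset.sum_coe_sort]
      refine le_trans (le_of_eq ?_) (h1.trans_eq (by ring))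
      exact Finset.sum_congr rfl fun x _ => dif_pos x.2
    · intro x hx a ha hopt
      dsimp only at hopt ⊢
      rw [hcx x hx, NNReal.coe_pow] at hopt
      rw [dif_pos hx]
      exact hRopt E hEN ⟨x, hx⟩ (f ⟨x, hx⟩) a ha hopt

/-- If the communication were below `u`, payments would be bounded by what the rounded menu
collects, a slack `γ'` per type and a charge for depth, which together fall short of the revenue
that approximate optimality forces. -/
theorem le_exAnteComm {Y : Finset (Finset (Finset (Fin n)))} {hY : Y.Nonempty}
    {c : Finset (Finset (Fin n)) → ℝ≥0} {k : ℕ} (hk0 : 0 < k) (hne : ∀ x ∈ Y, x.Nonempty)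
    (hkc : ∀ x ∈ Y, ∀ A ∈ x, A.card = k)
    (hcross : ∀ x ∈ Y, ∀ y ∈ Y, x ≠ y → 2 * ∑ A ∈ y, bxos x A ≤ y.card * k)
    (hc1 : ∀ x ∈ Y, c x ≤ 1) {a : ℝ} (ha : ∀ x ∈ Y, a ≤ c x) {τ Z u γ' : ℝ} (hτ : 0 < τ)
    (hZ0 : 0 < Z) (hu0 : 0 < u) (hγ' : γ' = 1 / Z) (hγ'1 : γ' ≤ 1) {ℓ m h M : ℕ}
    (hℓτ : 96 ≤ τ * ℓ) (hm0 : 0 < m) (hm : 1 / (m : ℝ) ≤ γ' / 4 * a) (hh0 : 0 < h)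
    (hh : 2 * Z / (γ' / 4) * u ≤ h) (hM : M = 2 ^ h * m)
    (hcsum : ℓ / (2 * Z) * Y.card ≤ ∑ x ∈ Y, (c x : ℝ))
    (hmenu : ∀ E ∈ menuClass n M h, (∃ a ∈ validEntries M E, a.2 = 0) →
        ∃ ρ : Finset (Finset (Fin n)) → ℝ, (∀ x, 0 ≤ ρ x) ∧
          ∑ x ∈ Y, ρ x ≤ 12 / Z * Y.card ∧
          ∀ x ∈ Y, ∀ a ∈ validEntries M E, (∀ a' ∈ validEntries M E,
            (c x : ℝ) * ((Entry.value a' fun S => (k : ℝ≥0∞)⁻¹ * bxos x S).toReal / M) -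
              (a'.2 : ℝ) / M ≤
            c x * ((Entry.value a fun S => (k : ℝ≥0∞)⁻¹ * bxos x S).toReal / M) - (a.2 : ℝ) / M +
              γ' * c x) → (a.2 : ℝ) / M ≤ ρ x)
    {P : Protocol n} (hIC : P.IsAlmostIC (γ' / 4).toNNReal (hardPrior Y hY c))
    (happ : P.IsApproxOptimal τ (hardPrior Y hY c)) :
    ENNReal.ofReal u ≤ P.exAnteComm (hardPrior Y hY c) := by
  by_contra! hlt
  have hY0 : (0 : ℝ) < Y.card := by exact_mod_cast hY.card_pos
  have hM0 : 0 < M := by rw [hM]; positivity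
  have hγ'0 : 0 < γ' := by rw [hγ']; positivity
  have hη0 : 0 < γ' / 4 := by linarith
  obtain ⟨hDfin, hDsum⟩ := sum_expDepth_le hu0.le hlt
  have hγ1 : (γ' / 4).toNNReal ≤ 1 := by
    rw [Real.toNNReal_le_one]
    linarith
  have hpay := fun x (hx : x ∈ Y) => scaledPay_le hIC hx hk0 (hkc x hx) (hc1 x hx) hγ1
  have happ' := sum_scale_le_sum_scaledPay hk0 hne hkc hcross hτ.le happ fun x hx =>
    ne_top_of_le_ne_top ENNReal.ofNat_ne_top (hpay x hx).1
  obtain ⟨x₀, hx₀⟩ := hY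
  obtain ⟨ρ, hρ0, hρsum, hρ⟩ := hmenu _ (roundMenu_mem M (k : ℝ≥0∞)⁻¹ h 1 P.tree)
    ((hpay x₀ hx₀).2.1 hM0 h)
  have hpoint : ∀ x ∈ Y,
      (P.tree.scaledPay (k : ℝ≥0∞)⁻¹ (P.suggested (scaledBxos c x))).toReal ≤
        ρ x + γ' + 2 / ((γ' / 4) * h) * (P.tree.expDepth (P.suggested (scaledBxos c x))).toReal := by
    intro x hx
    refine (hpay x hx).2.2 hh0 hm0 hM hη0 hγ'0.le (hρ0 x) ?_ (hDfin x hx) (hρ x hx)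
    rw [Real.coe_toNNReal (γ' / 4) (by linarith)]
    have h1 : (c x : ℝ) ≤ 1 := by exact_mod_cast hc1 x hx
    have h2 := ha x hx
    have h3 : (1 : ℝ) / m ≤ γ' / 4 * c x :=
      hm.trans (mul_le_mul_of_nonneg_left h2 (by positivity))
    have h4 : (c x : ℝ) / m ≤ 1 / m := by gcongr
    linarith
  have hsum := Finset.sum_le_sum hpoint
  rw [Finset.sum_add_distrib, Finset.sum_add_distrib, ← Finset.mul_sum, Finset.sum_const,
    nsmul_eq_mul] at hsum
  have hh' : (0 : ℝ) < h := by exact_mod_cast hh0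
  have hdepth : 2 / ((γ' / 4) * h) * ∑ x ∈ Y,
      (P.tree.expDepth (P.suggested (scaledBxos c x))).toReal ≤ Y.card * (1 / Z) := by
    calc _ ≤ 2 / ((γ' / 4) * h) * (Y.card * u) := by gcongr
      _ ≤ Y.card * (1 / Z) := by
        have h1 : 2 * Z * u ≤ (γ' / 4) * h := by
          rw [div_mul_eq_mul_div, div_le_iff₀ hη0] at hh
          linarith
        have h2 : 2 / ((γ' / 4) * h) * u ≤ 1 / Z := by
          rw [div_mul_eq_mul_div, div_le_div_iff₀ (by positivity) hZ0]
          linarith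
        calc 2 / ((γ' / 4) * h) * (Y.card * u) = Y.card * (2 / ((γ' / 4) * h) * u) := by ring
          _ ≤ _ := by gcongr
  have hlow : τ / 2 * (ℓ / (2 * Z) * Y.card) ≤ τ / 2 * ∑ x ∈ Y, (c x : ℝ) := by gcongr
  have h1 : τ / 2 * (ℓ / (2 * Z) * Y.card) = τ * ℓ / 4 * (Y.card / Z) := by
    field_simp
    ring
  have h2 : 12 / Z * (Y.card : ℝ) = 12 * (Y.card / Z) := by ring
  have h3 : (Y.card : ℝ) * γ' = Y.card / Z := by rw [hγ']; ring
  have h4 : (Y.card : ℝ) * (1 / Z) = Y.card / Z := by ring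
  have h5 : 0 < (Y.card : ℝ) / Z := by positivity
  -- In units of `|Y| / Z`, the revenue is at least `24`, but at most `12` from the rounded menu,
  -- `1` from the slack and `1` from the depth.
  have h6 : 24 * ((Y.card : ℝ) / Z) ≤ τ * ℓ / 4 * (Y.card / Z) := by
    gcongr
    linarith
  linarith

end Auction

/-! ### Choice of the parameters -/

open Auction in
theorem mainTheorem6 (τ : ℝ) (hτ : 0 < τ) (κ : ℝ) (hκ : 0 < κ) :
    ∃ (ε₀ δ₀ ε₁ δ₁ ε₂ : ℝ) (ℓ : ℕ) (α : ℝ) (γ : ℝ≥0) (n₀ : ℕ),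
      (0 < ε₀ ∧ ε₀ < κ) ∧ (0 < δ₀ ∧ δ₀ < κ) ∧ (0 < ε₁ ∧ ε₁ < κ) ∧ (0 < δ₁ ∧ δ₁ < κ) ∧
      (0 < ε₂ ∧ ε₂ < κ) ∧ 0 < α ∧ 0 < γ ∧
      ∀ n : ℕ, n₀ ≤ n →
        ∃ (X : Finset (Finset (Fin n))) (Y : Finset (Finset (Finset (Fin n))))
          (hY : Y.Nonempty) (c : Finset (Finset (Fin n)) → ℝ≥0),
          -- the nested designs
          Auction.IsDesign (Finset.univ : Finset (Fin n)) ε₀ δ₀ X ∧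
          (2 : ℝ) ^ (α * (n : ℝ)) ≤ (X.card : ℝ) ∧
          Auction.IsDesign X ε₁ δ₁ Y ∧
          (2 : ℝ) ^ (α * (X.card : ℝ)) ≤ (Y.card : ℝ) ∧
          (∀ x ∈ Y, ∃ i : ℕ, i < ℓ ∧ (c x : ℝ) = ε₂ ^ i) ∧
          -- all types are XOS
          (∀ v ∈ (Auction.hardPrior Y hY c).support, Auction.IsXOS v) ∧
          -- the communication lower bound
          ∀ P : Auction.Protocol n,
            P.IsAlmostIC γ (Auction.hardPrior Y hY c) →
            P.IsApproxOptimal τ (Auction.hardPrior Y hY c) →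
            ENNReal.ofReal ((2 : ℝ) ^ (α * (n : ℝ))) ≤ P.exAnteComm (Auction.hardPrior Y hY c) ∧
            ENNReal.ofReal ((2 : ℝ) ^ (α * (n : ℝ))) ≤ P.worstCaseComm := by
  obtain ⟨q, hq16, hqκ⟩ : ∃ q : ℕ, 16 ≤ q ∧ 1 / (q : ℝ) < κ := by
    obtain ⟨q, hq⟩ := exists_nat_gt (1 / κ)
    refine ⟨max 16 q, le_max_left _ _, ?_⟩
    have h1 : 1 / κ < ((max 16 q : ℕ) : ℝ) := hq.trans_le (by exact_mod_cast le_max_right _ _)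
    rw [div_lt_comm₀ hκ (by positivity)] at h1
    exact h1
  have hq0 : (0 : ℝ) < q := by positivity
  set δ : ℝ := min (κ / 2) 1 with hδ
  have hδ0 : 0 < δ := by positivity
  have hδ1 : δ ≤ 1 := min_le_right _ _
  have hδκ : δ < κ := (min_le_left _ _).trans_lt (by linarith)
  obtain ⟨e, he0, he, heκ⟩ : ∃ e : ℝ≥0, 0 < e ∧ e ≤ 1 / 2 ∧ (e : ℝ) < κ := by
    refine ⟨min (κ / 2).toNNReal (1 / 2), by positivity, min_le_right _ _, ?_⟩
    have : ((min (κ / 2).toNNReal (1 / 2) : ℝ≥0) : ℝ) ≤ κ / 2 := by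
      have h1 := NNReal.coe_le_coe.2 (min_le_left (κ / 2).toNNReal (1 / 2))
      rwa [Real.coe_toNNReal (κ / 2) (by positivity)] at h1
    linarith
  have her : (0 : ℝ) < e := by exact_mod_cast he0
  have her1 : (e : ℝ) ≤ 1 := by
    have : (e : ℝ) ≤ 1 / 2 := by exact_mod_cast he
    linarith
  set ℓ : ℕ := ⌈96 / τ⌉₊ with hℓ
  have hℓ0 : 0 < ℓ := Nat.ceil_pos.2 (by positivity)
  have hℓτ : 96 ≤ τ * ℓ := by
    have := Nat.le_ceil (96 / τ)
    rw [div_le_iff₀ hτ] at this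
    linarith
  set Z : ℝ := ∑ i ∈ Finset.range ℓ, ((e : ℝ) ^ i)⁻¹ with hZ
  have hℓZ : (ℓ : ℝ) ≤ Z := by
    have : ∑ i ∈ Finset.range ℓ, (1 : ℝ) ≤ Z := Finset.sum_le_sum fun i _ =>
      (one_le_inv₀ (by positivity)).2 (pow_le_one₀ her.le her1)
    simpa using this
  have hℓ1 : (1 : ℝ) ≤ ℓ := by exact_mod_cast hℓ0
  have hZ0 : 0 < Z := by linarith
  set γ' : ℝ := 1 / Z with hγ'
  have hγ'0 : 0 < γ' := by positivity
  have hγ'1 : γ' ≤ 1 := by rw [hγ', div_le_one hZ0]; linarith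
  have hγℓ : ℓ * γ' ≤ 1 := by rw [hγ', mul_one_div, div_le_one hZ0]; exact hℓZ
  -- Every scale is at least `e ^ ℓ`, so the rounding error `1 / m` is at most `γ' / 4` of any
  -- scale. The slack `γ'` is divided equally among the four error terms of
  -- `exists_almost_optimal_entry`.
  obtain ⟨m, hm0, hm⟩ : ∃ m : ℕ, 0 < m ∧ 1 / (m : ℝ) ≤ γ' / 4 * (e : ℝ) ^ ℓ := by
    have hpos : 0 < γ' / 4 * (e : ℝ) ^ ℓ := by positivity
    obtain ⟨m, hm⟩ := exists_nat_gt (1 / (γ' / 4 * (e : ℝ) ^ ℓ))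
    have hm0 : (0 : ℝ) < m := lt_trans (by positivity) hm
    refine ⟨m, by exact_mod_cast hm0, ?_⟩
    rw [div_lt_comm₀ hpos hm0] at hm
    exact hm.le
  set β : ℝ := δ ^ 2 / (8 * q ^ 2) with hβ
  have hβ0 : 0 < β := by positivity
  set η : ℝ := γ' / 4 with hη
  have hη0 : 0 < η := by positivity
  -- `K` and `θ` are the Chernoff exponent and half the mean scale in `exists_hard_scales`; `H`
  -- makes the charge for depth at most `1 / Z` per type.
  obtain ⟨n₁, hn₁⟩ := exists_depth (α := β / 2) (β₀ := β) (β₁ := β) (K := 4 / (3 * Z))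
    (θ := ℓ / (2 * Z)) (H := 2 * Z / η) (by positivity) (by linarith) hβ0 (by positivity)
    (by positivity) (by positivity) hm0
  have rpow_le : ∀ t : ℝ, 0 ≤ t → (2 : ℝ) ^ (β / 2 * t) ≤ Real.exp (β * t) := by
    intro t ht
    rw [Real.rpow_def_of_pos two_pos]
    apply Real.exp_le_exp.2
    have h1 : Real.log 2 ≤ 1 := by linarith [Real.log_two_lt_d9]
    have h2 : 0 ≤ β * t := by positivity
    nlinarith
  -- The term `2 * q / β` in `n₀` makes `X` large enough to carry the second design.
  refine ⟨1 / q, δ, 1 / q, δ, e, ℓ, β / 2, (γ' / 4).toNNReal,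
    max n₁ (max (2 * q) ⌈2 * q / β⌉₊), ⟨by positivity, hqκ⟩, ⟨hδ0, hδκ⟩, ⟨by positivity, hqκ⟩,
    ⟨hδ0, hδκ⟩, ⟨her, heκ⟩, by positivity, by positivity, fun n hn => ?_⟩
  have hn1 : n₁ ≤ n := (le_max_left _ _).trans hn
  have hn2 : 2 * q ≤ n := (le_max_left _ _).trans ((le_max_right _ _).trans hn)
  have hn3 : ⌈2 * q / β⌉₊ ≤ n := (le_max_right _ _).trans ((le_max_right _ _).trans hn)
  obtain ⟨X, hX, hXcard⟩ := exists_design (Finset.univ : Finset (Fin n)) q (by omega) hδ0 hδ1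
    (by simpa using hn2)
  rw [Finset.card_univ, Fintype.card_fin] at hXcard
  have hXq : 2 * q ≤ X.card := by
    have h1 : 2 * q / β ≤ n := (Nat.le_ceil _).trans (by exact_mod_cast hn3)
    rw [div_le_iff₀ hβ0] at h1
    have h2 := Real.add_one_le_exp (β * n)
    have h3 : ((2 * q : ℕ) : ℝ) ≤ X.card := by push_cast; linarith
    exact_mod_cast h3
  obtain ⟨Y, hYd, hYcard⟩ := exists_design X q (by omega) hδ0 hδ1 hXq
  have hY : Y.Nonempty := by
    rw [← Finset.card_pos]
    have h1 : (0 : ℝ) < Y.card := (Real.exp_pos _).trans_le hYcard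
    exact_mod_cast h1
  obtain ⟨h, hh0, hh, hcount⟩ := hn₁ n hn1
  have hcount' := hcount X.card Y.card hXcard hYcard
  set k := n / q with hk
  have hk0 : 0 < k := Nat.div_pos (by omega) (by omega)
  have hkc : ∀ x ∈ Y, ∀ A ∈ x, A.card = k := by
    intro x hx A hA
    rw [hX.card_eq A (hYd.subset x hx hA), Finset.card_univ, Fintype.card_fin,
      one_div_mul_eq_div, Nat.floor_div_natCast, Nat.floor_natCast]
  have hne : ∀ x ∈ Y, x.Nonempty := by
    intro x hx
    rw [← Finset.card_pos, hYd.card_eq x hx, one_div_mul_eq_div, Nat.floor_div_natCast,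
      Nat.floor_natCast]
    exact Nat.div_pos (by omega) (by omega)
  have hcross := two_mul_sum_bxos_le hq16 hq16 hδ1 hδ1 hX hYd (by omega) (by omega)
  set M := 2 ^ h * m with hM
  have hM0 : 0 < M := by positivity
  have hcard : ((menuClass n M h).card : ℝ) * Real.exp (-(4 / (3 * Z) * Y.card)) <
      ℓ / (2 * Z) := by
    refine lt_of_le_of_lt ?_ hcount'
    gcongr
    have := card_menuClass_le n M h
    omega
  obtain ⟨c, hc, hcsum, hmenu⟩ :=
    exists_hard_scales hY hk0 hkc he0 he hℓ0 hZ hγ'0.le hγℓ hM0 hcard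
  have hc1 : ∀ x ∈ Y, c x ≤ 1 := by
    intro x hx
    obtain ⟨i, _, hi⟩ := hc x hx
    rw [hi]
    exact pow_le_one₀ zero_le (by exact_mod_cast her1)
  have hcge : ∀ x ∈ Y, (e : ℝ) ^ ℓ ≤ c x := by
    intro x hx
    obtain ⟨i, hil, hi⟩ := hc x hx
    rw [hi, NNReal.coe_pow]
    exact pow_le_pow_of_le_one her.le her1 hil.le
  refine ⟨X, Y, hY, c, hX, (rpow_le n (Nat.cast_nonneg n)).trans hXcard, hYd,
    (rpow_le X.card (Nat.cast_nonneg _)).trans hYcard, ?_, ?_, fun P hIC happ => ?_⟩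
  · intro x hx
    obtain ⟨i, hi, hci⟩ := hc x hx
    exact ⟨i, hi, by rw [hci, NNReal.coe_pow]⟩
  · intro v hv
    obtain ⟨x, hx, rfl⟩ := (mem_support_hardPrior hY c v).1 hv
    exact isXOS_scaledBxos c (hne x hx)
  · have hex := le_exAnteComm hk0 hne hkc hcross hc1 hcge hτ hZ0 (by positivity) hγ' hγ'1 hℓτ hm0
      hm hh0 hh hM hcsum hmenu hIC happ
    exact ⟨hex, hex.trans (exAnteComm_le_worstCaseComm P _)⟩
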